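/- Let $\mathcal F_n$ ($n\ge 0$) be the $\sigma$-algebra on $\mathbb R$ generated by the dyadic intervals $[k2^{-n},(k+1)2^{-n})$, $k\in\mathbb Z$, let $\mathbb P$ be a Borel probability measure on $\mathbb R$, and let $\mathbb E_n$ be the conditional expectation given $\mathcal F_n$. For $0<p<\infty$ and $0<q\le\infty$ and a measurable $g:\mathbb R\to[0,\infty]$ put $$\|g\|_{p,q}=\Big(\sum_{j\in\mathbb Z}\Big(\int_{[j,j+1)}g^p\,d\mathbb P\Big)^{q/p}\Big)^{1/q}\quad(q<\infty),\qquad \|g\|_{p,\infty}=\sup_{j\in\mathbb Z}\Big(\int_{[j,j+1)}g^p\,d\mathbb P\Big)^{1/p}.$$ Let $\mathcal M$ be the set of all real martingales $f=(f_n)_{n\ge0}$ with respect to $(\mathcal F_n)$ and $\mathbb P$ with $f_0=0$ almost surely, and let $d_nf=f_n-f_{n-1}$ for $n\ge1$. For $f\in\mathcal M$ put $$f^*=\sup_{n}|f_n|,\quad S_n(f)=\Big(\sum_{i=1}^n|d_if|^2\Big)^{1/2},\quad S(f)=\Big(\sum_{i\ge1}|d_if|^2\Big)^{1/2},\quad s(f)=\Big(\sum_{i\ge1}\mathbb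 E_{i-1}|d_if|^2\Big)^{1/2},$$ $$\|f\|_{H^*_{p,q}}=\|f^*\|_{p,q},\quad \|f\|_{H^S_{p,q}}=\|S(f)\|_{p,q},\quad \|f\|_{H^s_{p,q}}=\|s(f)\|_{p,q}.$$ Let $\|f\|_{\mathcal P_{p,q}}$ (respectively $\|f\|_{\mathcal Q_{p,q}}$) be the infimum of $\|\lim_n\varrho_n\|_{p,q}$ over all non-decreasing sequences $(\varrho_n)_{n\ge0}$ of functions $\varrho_n:\mathbb R\to[0,\infty)$, with $\varrho_n$ $\mathcal F_n$-measurable, such that for all $n\ge1$, almost surely, $|f_n|\le\varrho_{n-1}$ (respectively $S_n(f)\le\varrho_{n-1}$); the infimum of the empty set is $\infty$. Each of the five spaces $H^*_{p,q},H^S_{p,q},H^s_{p,q},\mathcal P_{p,q},\mathcal Q_{p,q}$ consists of the $f\in\mathcal M$ for which the corresponding quantity is finite. For every $0<p<\infty$ there is a finite constant $C$ depending only on $p$ such that, for every $\mathbb P$, every $0<q\le\infty$ and every $f\in\mathcal M$: (i) if $p\le2$, then $\|f\|_{H^*_{p,q}}\le C\|f\|_{H^s_{p,q}}$ and $\|f\|_{H^S_{p,q}}\le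 C\|f\|_{H^s_{p,q}}$; (ii) if $p\ge2$, then $\|f\|_{H^s_{p,q}}\le C\|f\|_{H^*_{p,q}}$ and $\|f\|_{H^s_{p,q}}\le C\|f\|_{H^S_{p,q}}$; (iii) $\|f\|_{H^*_{p,q}}\le C\|f\|_{\mathcal P_{p,q}}$ and $\|f\|_{H^S_{p,q}}\le C\|f\|_{\mathcal Q_{p,q}}$; (iv) $\|f\|_{H^*_{p,q}}\le C\|f\|_{\mathcal Q_{p,q}}$ and $\|f\|_{H^S_{p,q}}\le C\|f\|_{\mathcal P_{p,q}}$; (v) $\|f\|_{H^s_{p,q}}\le C\|f\|_{\mathcal P_{p,q}}$ and $\|f\|_{H^s_{p,q}}\le C\|f\|_{\mathcal Q_{p,q}}$. In particular the corresponding inclusions between the spaces hold. Moreover, if $(\mathcal F_n)$ is regular for $\mathbb P$, that is, if there is $R>0$ such that $g_n\le R\,g_{n-1}$ almost surely for all $n\ge1$ and every non-negative martingale $(g_n)_{n\ge0}$ with respect to $(\mathcal F_n)$ and $\mathbb P$ (with $g_0$ arbitrary), then for all $0<p<\infty$ and $0<q\le\infty$ the five spaces coincide and their (quasi-)norms are pairwise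 equivalent, with constants depending only on $p$ and $R$. -/

import Mathlib

open MeasureTheory Set
open scoped ENNReal NNReal

namespace HardyAmalgam

/-- The dyadic interval `[k / 2 ^ n, (k + 1) / 2 ^ n)`. -/
def dyadicInterval (n : ℕ) (k : ℤ) : Set ℝ :=
  Ico ((k : ℝ) / 2 ^ n) (((k : ℝ) + 1) / 2 ^ n)

theorem dyadicInterval_eq_union (n : ℕ) (k : ℤ) :
    dyadicInterval n k = dyadicInterval (n + 1) (2 * k) ∪ dyadicInterval (n + 1) (2 * k + 1) := by
  have h : (0 : ℝ) < 2 ^ n := by positivity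
  have e1 : (((2 * k : ℤ) : ℝ)) / 2 ^ (n + 1) = (k : ℝ) / 2 ^ n := by
    push_cast; field_simp; ring
  have e2 : ((((2 * k + 1 : ℤ) : ℝ)) + 1) / 2 ^ (n + 1) = ((k : ℝ) + 1) / 2 ^ n := by
    push_cast; field_simp; ring
  have e3 : ((((2 * k : ℤ) : ℝ)) + 1) / 2 ^ (n + 1) = (((2 * k + 1 : ℤ) : ℝ)) / 2 ^ (n + 1) := by
    push_cast; ring
  unfold dyadicInterval
  rw [e1, e2, e3, Ico_union_Ico_eq_Ico]
  · rw [← e1]; gcongr; linarith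
  · rw [← e2]; gcongr; linarith

/-- The dyadic filtration of `ℝ`: the `n`-th σ-algebra is generated by the dyadic intervals of
length `2 ^ (-n)`. -/
def dyadicFiltration : Filtration ℕ (inferInstance : MeasurableSpace ℝ) where
  seq n := MeasurableSpace.generateFrom (range (dyadicInterval n))
  mono' := by
    refine monotone_nat_of_le_succ fun n => MeasurableSpace.generateFrom_le ?_
    rintro _ ⟨k, rfl⟩
    rw [dyadicInterval_eq_union]
    exact MeasurableSet.union (MeasurableSpace.measurableSet_generateFrom (mem_range_self _))
      (MeasurableSpace.measurableSet_generateFrom (mem_range_self _))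
  le' n := by
    refine MeasurableSpace.generateFrom_le ?_
    rintro _ ⟨k, rfl⟩
    exact measurableSet_Ico

noncomputable section

/-- The (quasi-)norm of the Wiener amalgam space of `L_p(P)` and `ℓ_q` over the cover
`A_j = [j, j + 1)`, `j ∈ ℤ`, for `0 < p, q ≤ ∞`. -/
def amalgamNorm (P : Measure ℝ) (p q : ℝ≥0∞) (g : ℝ → ℝ≥0∞) : ℝ≥0∞ :=
  if q = ∞ then ⨆ j : ℤ, eLpNorm g p (P.restrict (Ico (j : ℝ) (j + 1)))
  else (∑' j : ℤ, eLpNorm g p (P.restrict (Ico (j : ℝ) (j + 1))) ^ q.toReal) ^ (1 / q.toReal)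

/-- Real martingales for the dyadic filtration, with the convention `f₀ = 0`. -/
def IsDyadicMartingale (P : Measure ℝ) (f : ℕ → ℝ → ℝ) : Prop :=
  Martingale f dyadicFiltration P ∧ f 0 =ᵐ[P] 0

/-- The maximal function `f^* = sup_n |f_n|`. -/
def maximalFunction (f : ℕ → ℝ → ℝ) (x : ℝ) : ℝ≥0∞ :=
  ⨆ n, ‖f n x‖ₑ

/-- The `n`-th quadratic variation `S_n(f)`; the term `d_0 f = 0` is left out. -/
def partialSquareFunction (f : ℕ → ℝ → ℝ) (n : ℕ) (x : ℝ) : ℝ≥0∞ :=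
  (∑ i ∈ Finset.range n, ‖f (i + 1) x - f i x‖ₑ ^ 2) ^ (1 / 2 : ℝ)

/-- The quadratic variation `S(f)`. -/
def squareFunction (f : ℕ → ℝ → ℝ) (x : ℝ) : ℝ≥0∞ :=
  (∑' i, ‖f (i + 1) x - f i x‖ₑ ^ 2) ^ (1 / 2 : ℝ)

/-- The conditional quadratic variation `s(f)`. The conditional expectation is that of
`[0, ∞]`-valued functions, since `|d_n f|²` need not be integrable. -/
def condSquareFunction (P : Measure ℝ) (f : ℕ → ℝ → ℝ) (x : ℝ) : ℝ≥0∞ :=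
  (∑' i, condLExp (dyadicFiltration i) P (fun y => ‖f (i + 1) y - f i y‖ₑ ^ 2) x) ^ (1 / 2 : ℝ)

/-- Adapted non-decreasing sequences of non-negative functions. -/
def IsControl (ϱ : ℕ → ℝ → ℝ≥0) : Prop :=
  Adapted dyadicFiltration ϱ ∧ Monotone ϱ

/-- `ϱ_∞ = lim_n ϱ_n` for a non-decreasing sequence `ϱ`. -/
def controlLimit (ϱ : ℕ → ℝ → ℝ≥0) (x : ℝ) : ℝ≥0∞ :=
  ⨆ n, (ϱ n x : ℝ≥0∞)

/-- The (quasi-)norm of `P_{p,q}`: the infimum of `‖ϱ_∞‖_{p,q}` over the controls `ϱ` with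
`|f_n| ≤ ϱ_{n-1}` for all `n ≥ 1` (infinite if no such control has a finite norm). -/
def predictableNorm (P : Measure ℝ) (p q : ℝ≥0∞) (f : ℕ → ℝ → ℝ) : ℝ≥0∞ :=
  ⨅ (ϱ : ℕ → ℝ → ℝ≥0) (_ : IsControl ϱ)
    (_ : ∀ n, ∀ᵐ x ∂P, ‖f (n + 1) x‖ₑ ≤ (ϱ n x : ℝ≥0∞)), amalgamNorm P p q (controlLimit ϱ)

/-- The (quasi-)norm of `Q_{p,q}`: the same with `S_n(f) ≤ ϱ_{n-1}` for all `n ≥ 1`. -/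
def predictableSquareNorm (P : Measure ℝ) (p q : ℝ≥0∞) (f : ℕ → ℝ → ℝ) : ℝ≥0∞ :=
  ⨅ (ϱ : ℕ → ℝ → ℝ≥0) (_ : IsControl ϱ)
    (_ : ∀ n, ∀ᵐ x ∂P, partialSquareFunction f (n + 1) x ≤ (ϱ n x : ℝ≥0∞)),
    amalgamNorm P p q (controlLimit ϱ)

/-- Labels for the five scales `H^*`, `H^S`, `H^s`, `P`, `Q`. -/
inductive Scale
  | Hstar
  | HS
  | Hs
  | P
  | Q

/-- The (quasi-)norm of the Hardy-amalgam space with the given label; it takes the value `∞`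
outside that space. -/
def hardyNorm (P : Measure ℝ) (p q : ℝ≥0∞) : Scale → (ℕ → ℝ → ℝ) → ℝ≥0∞
  | .Hstar, f => amalgamNorm P p q (maximalFunction f)
  | .HS, f => amalgamNorm P p q (squareFunction f)
  | .Hs, f => amalgamNorm P p q (condSquareFunction P f)
  | .P, f => predictableNorm P p q f
  | .Q, f => predictableSquareNorm P p q f

/-- The Hardy-amalgam space with the given label. -/
def hardySpace (P : Measure ℝ) (p q : ℝ≥0∞) (X : Scale) : Set (ℕ → ℝ → ℝ) :=
  {f | IsDyadicMartingale P f ∧ hardyNorm P p q X f < ∞}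

/-- `X_{p,q}` embeds continuously into `Y_{p,q}` with constant `C`. -/
def EmbedsWith (P : Measure ℝ) (p q : ℝ≥0∞) (X Y : Scale) (C : ℝ≥0) : Prop :=
  hardySpace P p q X ⊆ hardySpace P p q Y ∧
    ∀ f, IsDyadicMartingale P f → hardyNorm P p q Y f ≤ C * hardyNorm P p q X f

/-- The dyadic filtration is regular for `P` with constant `R`: `f_n ≤ R f_{n-1}` for every
non-negative martingale `f` (here `f₀` is not required to vanish) and all `n ≥ 1`. -/
def IsRegularBasis (P : Measure ℝ) (R : ℝ) : Prop :=
  ∀ f : ℕ → ℝ → ℝ, Martingale f dyadicFiltration P → (∀ n, 0 ≤ᵐ[P] f n) →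
    ∀ n, ∀ᵐ x ∂P, f (n + 1) x ≤ R * f n x

end

end HardyAmalgam

open HardyAmalgam

/-! Each unit interval `[j, j + 1)` belongs to the coarsest σ-algebra and contains only `2 ^ n`
atoms of level `n`. Hence adapted functions are bounded on it, all moments at finite levels are
finite, and the martingale may be studied on each unit interval separately. It suffices to prove an
`L_p` inequality there at every finite level, with a constant depending on `p` only; monotone
convergence gives the limit, and an inequality valid for every `j` with one constant passes to the
`ℓ_q` norm for every `q`.

For `p ≤ 2` the tool is a predictable weight: `W i` is positive, non-decreasing in `i` and of level
`i`, while it multiplies the increment from `i` to `i + 1`. Up to constants, the `p`-th moments of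
`f^*`, `S(f)` and `s(f)` are bounded by `∑ W i ^ (p - 2) |f (i + 1) - f i|²` and `W N ^ p` in the
mean. For the two square functions this is elementary (`rpow_half_le`); for `f^*` it is Doob's
inequality in `L_2` for the transform of `f` by `W ^ (-(2 - p) / 2)`, followed by summation by
parts. The weighted sum is in turn bounded by the mean of `W N ^ p` as soon as `W n` dominates the
conditional square function, the square function or `|f|` at time `n + 1`, because `t ^ (p / 2)` is
concave and the sums telescope. Taking for `W` the conditional square function itself gives (i);
taking a control gives the other cases.

For `p ≥ 2` convexity replaces concavity. The power `(∑ a_i) ^ (p / 2)` is at most a multiple of a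
sum of the `a_i` with predictable weights; there conditional squares may be exchanged for squares,
or for increments of `f²`, and Young's inequality absorbs the weight. This gives (ii). Bounding
`f^*` by `S(f)` uses a second order Taylor expansion of `|t| ^ p`, whose linear terms have mean
zero, and Doob's inequality. Bounding `S(f)` by a control of `|f|` uses the predictable majorant
`S_n² + 4 W_n²` of `S_{n+1}²`.

In the regular case a non-negative function of level `n + 1` is at most `R` times its average at
level `n`. This makes `|f (n + 1) - f n|²` at most `R` times its conditional expectation, and gives
any adapted non-decreasing sequence a control of comparable size (`exists_control_of_regular`), so
that all five spaces embed into one another. -/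

namespace HardyAmalgam

/-! ### Functions constant on dyadic intervals -/

section

/-- `h` is constant on the dyadic intervals of length `2 ^ (-n)`. -/
def LevelConst {α : Type*} (n : ℕ) (h : ℝ → α) : Prop :=
  ∀ ⦃x y : ℝ⦄, ⌊(2 : ℝ) ^ n * x⌋ = ⌊(2 : ℝ) ^ n * y⌋ → h x = h y

theorem mem_dyadicInterval_iff {n : ℕ} {k : ℤ} {x : ℝ} :
    x ∈ dyadicInterval n k ↔ ⌊(2 : ℝ) ^ n * x⌋ = k := by
  have h : (0 : ℝ) < 2 ^ n := by positivity
  rw [Int.floor_eq_iff, dyadicInterval, mem_Ico, div_le_iff₀ h, lt_div_iff₀ h, mul_comm x]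

theorem floor_two_pow_mul_eq_of_le {m n : ℕ} (hmn : m ≤ n) {x y : ℝ}
    (h : ⌊(2 : ℝ) ^ n * x⌋ = ⌊(2 : ℝ) ^ n * y⌋) : ⌊(2 : ℝ) ^ m * x⌋ = ⌊(2 : ℝ) ^ m * y⌋ := by
  have key : ∀ z : ℝ, ⌊(2 : ℝ) ^ m * z⌋ = ⌊(2 : ℝ) ^ n * z⌋ / ((2 ^ (n - m) : ℕ) : ℤ) := by
    intro z
    rw [← Int.floor_div_natCast]
    congr 1
    obtain ⟨k, rfl⟩ := Nat.exists_eq_add_of_le hmn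
    simp only [Nat.add_sub_cancel_left, Nat.cast_pow, Nat.cast_ofNat]
    field_simp
    ring
  rw [key, key, h]

theorem LevelConst.mono {α : Type*} {m n : ℕ} {h : ℝ → α} (hh : LevelConst m h) (hmn : m ≤ n) :
    LevelConst n h :=
  fun _ _ e => hh (floor_two_pow_mul_eq_of_le hmn e)

theorem LevelConst.const {α : Type*} (n : ℕ) (c : α) : LevelConst n (fun _ : ℝ => c) :=
  fun _ _ _ => rfl

theorem LevelConst.comp {α β : Type*} {n : ℕ} {h : ℝ → α} (hh : LevelConst n h) (φ : α → β) :
    LevelConst n (fun x => φ (h x)) :=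
  fun _ _ e => by simp only [hh e]

theorem LevelConst.comp₂ {α β γ : Type*} {n : ℕ} {h : ℝ → α} {g : ℝ → β} (hh : LevelConst n h)
    (hg : LevelConst n g) (φ : α → β → γ) : LevelConst n (fun x => φ (h x) (g x)) :=
  fun _ _ e => by simp only [hh e, hg e]

theorem LevelConst.sum {ι : Type*} {n : ℕ} {s : Finset ι} {h : ι → ℝ → ℝ}
    (hh : ∀ i ∈ s, LevelConst n (h i)) : LevelConst n (fun x => ∑ i ∈ s, h i x) :=
  fun _ _ e => Finset.sum_congr rfl fun i hi => hh i hi e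

/-- The sets that do not separate points of one dyadic interval form a σ-algebra containing the
generators. Measurability at level `n` thus becomes a statement about all points, with no
exceptional null set. -/
theorem mem_iff_of_measurableSet {n : ℕ} {s : Set ℝ} (hs : MeasurableSet[dyadicFiltration n] s)
    {x y : ℝ} (h : ⌊(2 : ℝ) ^ n * x⌋ = ⌊(2 : ℝ) ^ n * y⌋) : x ∈ s ↔ y ∈ s := by
  induction s, hs using MeasurableSpace.generateFrom_induction with
  | hC t ht _ =>
    obtain ⟨k, rfl⟩ := ht
    rw [mem_dyadicInterval_iff, mem_dyadicInterval_iff, h]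
  | empty => simp
  | compl t _ ih => simp only [mem_compl_iff, ih]
  | iUnion t _ ih => simp only [mem_iUnion, ih]

theorem LevelConst.of_measurable {α : Type*} [MeasurableSpace α] [MeasurableSingletonClass α]
    {n : ℕ} {h : ℝ → α} (hh : Measurable[dyadicFiltration n] h) : LevelConst n h := by
  intro x y e
  have := (mem_iff_of_measurableSet (hh (measurableSet_singleton (h x))) e).1 rfl
  exact this.symm

theorem measurableSet_dyadicInterval (n : ℕ) (k : ℤ) :
    MeasurableSet[dyadicFiltration n] (dyadicInterval n k) :=
  MeasurableSpace.measurableSet_generateFrom (mem_range_self _)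

theorem LevelConst.measurable_filtration {α : Type*} [MeasurableSpace α] {n : ℕ} {h : ℝ → α}
    (hh : LevelConst n h) : Measurable[dyadicFiltration n] h := by
  intro t _
  have : h ⁻¹' t = ⋃ k ∈ {k : ℤ | ∃ x, ⌊(2 : ℝ) ^ n * x⌋ = k ∧ h x ∈ t}, dyadicInterval n k := by
    ext x
    simp only [mem_preimage, mem_ofPred_eq, mem_iUnion, mem_dyadicInterval_iff, exists_prop]
    constructor
    · intro hx
      exact ⟨_, ⟨x, rfl, hx⟩, rfl⟩
    · rintro ⟨k, ⟨y, hy, hyt⟩, hx⟩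
      rwa [hh (hx.trans hy.symm)]
  rw [this]
  exact MeasurableSet.biUnion (to_countable _) fun k _ => measurableSet_dyadicInterval n k

theorem LevelConst.measurable {α : Type*} [MeasurableSpace α] {n : ℕ} {h : ℝ → α}
    (hh : LevelConst n h) : Measurable h :=
  hh.measurable_filtration.mono (dyadicFiltration.le n) le_rfl

theorem floor_mem_of_mem_unit {n : ℕ} {j : ℤ} {x : ℝ} (hx : x ∈ Ico (j : ℝ) (j + 1)) :
    ⌊(2 : ℝ) ^ n * x⌋ ∈ Finset.Ico (j * 2 ^ n) ((j + 1) * 2 ^ n) := by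
  have h : (0 : ℝ) < 2 ^ n := by positivity
  rw [Finset.mem_Ico]
  constructor
  · rw [Int.le_floor]
    push_cast
    nlinarith [hx.1]
  · rw [Int.floor_lt]
    push_cast
    nlinarith [hx.2]

theorem unit_eq_biUnion (n : ℕ) (j : ℤ) :
    Ico (j : ℝ) (j + 1) =
      ⋃ k ∈ Finset.Ico (j * 2 ^ n) ((j + 1) * 2 ^ n), dyadicInterval n k := by
  have h : (0 : ℝ) < 2 ^ n := by positivity
  ext x
  simp only [mem_iUnion, mem_dyadicInterval_iff, exists_prop]
  constructor
  · intro hx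
    exact ⟨_, floor_mem_of_mem_unit hx, rfl⟩
  · rintro ⟨k, hk, rfl⟩
    rw [Finset.mem_Ico, Int.le_floor, Int.floor_lt] at hk
    push_cast at hk
    constructor <;> nlinarith [hk.1, hk.2]

theorem pairwise_disjoint_dyadicInterval (n : ℕ) :
    Pairwise (Function.onFun Disjoint (dyadicInterval n)) := by
  intro k l hkl
  refine Set.disjoint_left.2 fun x hk hl => hkl ?_
  rw [mem_dyadicInterval_iff] at hk hl
  exact hk.symm.trans hl

/-- The restriction of `P` to the unit interval `[j, j + 1)`. -/
noncomputable abbrev unitRestrict (P : Measure ℝ) (j : ℤ) : Measure ℝ :=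
  P.restrict (Ico (j : ℝ) (j + 1))

/-- On a unit interval such a function takes at most `2 ^ n` values, namely those at the left
endpoints `k / 2 ^ n`. This is why no moment assumption on the martingale is needed anywhere below.
-/
theorem LevelConst.integrable {P : Measure ℝ} [IsFiniteMeasure P] {j : ℤ} {n : ℕ} {h : ℝ → ℝ}
    (hh : LevelConst n h) : Integrable h (unitRestrict P j) := by
  refine Measure.integrableOn_of_bounded (measure_ne_top _ _) hh.measurable.aestronglyMeasurable
    (M := ∑ k ∈ Finset.Ico (j * 2 ^ n) ((j + 1) * 2 ^ n), |h ((k : ℝ) / 2 ^ n)|) ?_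
  rw [ae_restrict_iff' measurableSet_Ico]
  refine Filter.Eventually.of_forall fun x hx => ?_
  have e : h x = h ((⌊(2 : ℝ) ^ n * x⌋ : ℝ) / 2 ^ n) := by
    apply hh
    rw [mul_div_cancel₀ _ (by positivity), Int.floor_intCast]
  rw [Real.norm_eq_abs, e]
  exact Finset.single_le_sum (f := fun k : ℤ => |h ((k : ℝ) / 2 ^ n)|)
    (fun k _ => abs_nonneg _) (floor_mem_of_mem_unit hx)

theorem dyadicInterval_subset_unit {n : ℕ} {j k : ℤ}
    (hk : k ∈ Finset.Ico (j * 2 ^ n) ((j + 1) * 2 ^ n)) :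
    dyadicInterval n k ⊆ Ico (j : ℝ) (j + 1) := by
  rw [unit_eq_biUnion n j]
  exact Set.subset_biUnion_of_mem (u := fun k => dyadicInterval n k) (Finset.mem_coe.2 hk)

theorem integral_unit_eq_sum {P : Measure ℝ} {j : ℤ} (n : ℕ) {h : ℝ → ℝ}
    (hh : Integrable h (unitRestrict P j)) :
    ∫ x, h x ∂(unitRestrict P j) =
      ∑ k ∈ Finset.Ico (j * 2 ^ n) ((j + 1) * 2 ^ n), ∫ x in dyadicInterval n k, h x ∂P := by
  rw [unitRestrict, unit_eq_biUnion n j]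
  refine integral_biUnion_finset _ (fun k _ => measurableSet_Ico)
    (fun k _ l _ hkl => pairwise_disjoint_dyadicInterval n hkl) fun k hk => ?_
  exact IntegrableOn.mono_set hh (dyadicInterval_subset_unit hk)

/-- The factor `ξ` is constant on each atom of level `n` and leaves the integral. Conditional
expectation identities are used below only in this tested form. -/
theorem integral_mul_congr_of_atoms {P : Measure ℝ} [IsFiniteMeasure P] {j : ℤ} {n m : ℕ}
    {g h ξ : ℝ → ℝ} (hg : LevelConst m g) (hh : LevelConst m h) (hξ : LevelConst n ξ)
    (e : ∀ k ∈ Finset.Ico (j * 2 ^ n) ((j + 1) * 2 ^ n),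
      ∫ x in dyadicInterval n k, g x ∂P = ∫ x in dyadicInterval n k, h x ∂P) :
    ∫ x, ξ x * g x ∂(unitRestrict P j) = ∫ x, ξ x * h x ∂(unitRestrict P j) := by
  have aux : ∀ g : ℝ → ℝ, LevelConst m g → Integrable (fun x => ξ x * g x) (unitRestrict P j) :=
    fun g hg => ((hξ.mono (le_max_left n m)).comp₂ (hg.mono (le_max_right n m))
      (fun a b => a * b)).integrable
  have pull : ∀ (g : ℝ → ℝ) (k : ℤ), ∫ x in dyadicInterval n k, ξ x * g x ∂P =
      ξ ((k : ℝ) / 2 ^ n) * ∫ x in dyadicInterval n k, g x ∂P := by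
    intro g k
    rw [← integral_const_mul]
    refine setIntegral_congr_fun measurableSet_Ico fun x hx => ?_
    rw [show ξ x = ξ ((k : ℝ) / 2 ^ n) from hξ ?_]
    rw [mul_div_cancel₀ _ (by positivity), Int.floor_intCast]
    exact mem_dyadicInterval_iff.1 hx
  rw [integral_unit_eq_sum n (aux g hg), integral_unit_eq_sum n (aux h hh)]
  refine Finset.sum_congr rfl fun k hk => ?_
  rw [pull, pull, e k hk]

end

/-! ### Elementary inequalities for real powers -/

section

/-- The convex function `t ^ r` lies above its tangent at `a`; dividing by `a ^ r` turns this into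
Bernoulli's inequality. The point `a = 0` is separate since `0 ^ (r - 1)` is `1` for `r = 1`. -/
theorem rpow_tangent_le {a b r : ℝ} (ha : 0 ≤ a) (hb : 0 ≤ b) (hr : 1 ≤ r) :
    a ^ r + r * a ^ (r - 1) * (b - a) ≤ b ^ r := by
  rcases ha.eq_or_lt with rfl | ha
  · rcases hr.eq_or_lt with rfl | hr
    · simp
    · rw [Real.zero_rpow (by linarith), Real.zero_rpow (by linarith)]
      have := Real.rpow_nonneg hb r
      linarith
  · have h := one_add_mul_self_le_rpow_one_add (s := b / a - 1)
      (by have := div_nonneg hb ha.le; linarith) hr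
    rw [add_sub_cancel, Real.div_rpow hb ha.le, le_div_iff₀ (Real.rpow_pos_of_pos ha r)] at h
    refine le_trans (le_of_eq ?_) h
    rw [Real.rpow_sub_one ha.ne']
    field_simp

theorem mul_rpow_sub_one {a r : ℝ} (ha : 0 ≤ a) (hr : 1 ≤ r) : a * a ^ (r - 1) = a ^ r := by
  rcases ha.eq_or_lt with rfl | ha
  · rw [zero_mul, Real.zero_rpow (by linarith)]
  · rw [Real.rpow_sub_one ha.ne', mul_div_cancel₀ _ ha.ne']

theorem rpow_sub_rpow_le {u v r : ℝ} (hu : 0 ≤ u) (hv : 0 ≤ v) (hr : 1 ≤ r) :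
    v ^ r - u ^ r ≤ r * ((v - u) * v ^ (r - 1)) := by
  have := rpow_tangent_le hv hu hr
  linarith

/-- Young's inequality with coefficient `1 / 2` on `y ^ r`, so that this term can be absorbed.
Either `c * x ≤ y / 2`, or `y ≤ 2 * c * x` bounds the power of `y`. -/
theorem mul_rpow_sub_one_le {c x y r : ℝ} (hc : 0 ≤ c) (hx : 0 ≤ x) (hy : 0 ≤ y) (hr : 1 ≤ r) :
    c * (x * y ^ (r - 1)) ≤ y ^ r / 2 + c * (2 * c) ^ (r - 1) * x ^ r := by
  have h1 : 0 ≤ y ^ r := Real.rpow_nonneg hy r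
  have h2 : 0 ≤ c * (2 * c) ^ (r - 1) * x ^ r := by positivity
  rcases le_total (2 * c * x) y with h | h
  · have : (c * x) * y ^ (r - 1) ≤ (y / 2) * y ^ (r - 1) := by gcongr; linarith
    have e := mul_rpow_sub_one hy hr
    nlinarith
  · have : c * (x * y ^ (r - 1)) ≤ c * (x * (2 * c * x) ^ (r - 1)) := by gcongr
    rw [Real.mul_rpow (by positivity) hx] at this
    have e := mul_rpow_sub_one hx hr
    have : c * (x * ((2 * c) ^ (r - 1) * x ^ (r - 1))) = c * (2 * c) ^ (r - 1) * x ^ r := by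
      rw [← e]; ring
    linarith

/-- Concavity of `t ^ (p / 2)`: its slope at `v` is `p / 2 * v ^ (p / 2 - 1)`, and the exponent is
non-positive, so replacing `v` by the larger `w ^ 2` only decreases the power. It makes sums with
weights `w ^ (p - 2)` telescope. -/
theorem sub_mul_rpow_le {u v w p : ℝ} (hp : 0 < p) (hp2 : p ≤ 2) (hu : 0 ≤ u) (huv : u ≤ v)
    (hw : 0 < w) (hvw : v ≤ w ^ 2) :
    (v - u) * w ^ (p - 2) ≤ 2 / p * (v ^ (p / 2) - u ^ (p / 2)) := by
  rcases huv.eq_or_lt with rfl | huv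
  · simp
  have hv : 0 < v := hu.trans_lt huv
  have h1 : w ^ (p - 2) ≤ v ^ (p / 2 - 1) := by
    have : w ^ (p - 2) = (w ^ 2) ^ (p / 2 - 1) := by
      rw [← Real.rpow_natCast_mul hw.le]
      congr 1
      push_cast
      ring
    rw [this]
    exact Real.rpow_le_rpow_of_nonpos hv hvw (by linarith)
  have h2 := rpow_one_add_le_one_add_mul_self (s := u / v - 1) (p := p / 2)
    (by have := div_nonneg hu hv.le; linarith) (by linarith) (by linarith)
  rw [add_sub_cancel, Real.div_rpow hu hv.le, div_le_iff₀ (Real.rpow_pos_of_pos hv _)] at h2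
  have h3 : (v - u) * v ^ (p / 2 - 1) ≤ 2 / p * (v ^ (p / 2) - u ^ (p / 2)) := by
    rw [div_mul_eq_mul_div, le_div_iff₀ hp]
    rw [Real.rpow_sub_one hv.ne']
    have : (1 + p / 2 * (u / v - 1)) * v ^ (p / 2) =
      v ^ (p / 2) - p / 2 * ((v - u) * (v ^ (p / 2) / v)) := by field_simp; ring
    linarith
  exact (mul_le_mul_of_nonneg_left h1 (by linarith)).trans h3

/-- If `q ≤ w ^ 2` the second term suffices; otherwise `q ^ (p / 2 - 1) ≤ w ^ (p - 2)` and the first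
one does. This takes the place of Hölder's inequality. -/
theorem rpow_half_le {q w p : ℝ} (hp : 0 < p) (hp2 : p ≤ 2) (hq : 0 ≤ q) (hw : 0 < w) :
    q ^ (p / 2) ≤ q * w ^ (p - 2) + w ^ p := by
  have e : ∀ s : ℝ, (w ^ 2) ^ (s / 2) = w ^ s := by
    intro s
    rw [← Real.rpow_natCast_mul hw.le]
    congr 1
    push_cast
    ring
  rcases le_total q (w ^ 2) with h | h
  · have : q ^ (p / 2) ≤ (w ^ 2) ^ (p / 2) := by gcongr
    rw [e] at this
    have : 0 ≤ q * w ^ (p - 2) := by positivity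
    linarith
  · have hq' : 0 < q := lt_of_lt_of_le (by positivity) h
    have h1 : q ^ ((p - 2) / 2) ≤ (w ^ 2) ^ ((p - 2) / 2) :=
      Real.rpow_le_rpow_of_nonpos (by positivity) h (by linarith)
    rw [e] at h1
    have h2 : q * q ^ ((p - 2) / 2) = q ^ (p / 2) := by
      rw [show (p - 2) / 2 = p / 2 - 1 by ring, Real.rpow_sub_one hq'.ne',
        mul_div_cancel₀ _ hq'.ne']
    have : 0 ≤ w ^ p := by positivity
    nlinarith

theorem sq_mul_rpow_sub_two {w p : ℝ} (hw : 0 < w) : w ^ 2 * w ^ (p - 2) = w ^ p := by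
  rw [← Real.rpow_natCast, ← Real.rpow_add hw]
  congr 1
  push_cast
  ring

/-- With `t ^ 2` replaced by `u ^ 2`, the left side is `(v ^ 2 - u ^ 2) * v ^ (p - 2) - (v ^ p - u ^
p)`, and `sub_mul_rpow_le` bounds the first term. -/
theorem sq_mul_rpow_sub_le {t u v p : ℝ} (hp : 0 < p) (hp2 : p ≤ 2) (hu : 0 < u) (huv : u ≤ v)
    (ht : t ^ 2 ≤ u ^ 2) :
    t ^ 2 * (u ^ (p - 2) - v ^ (p - 2)) ≤ 2 / p * (v ^ p - u ^ p) := by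
  have hv : 0 < v := hu.trans_le huv
  have h1 := sub_mul_rpow_le (u := u ^ 2) (v := v ^ 2) hp hp2 (by positivity) (by gcongr) hv le_rfl
  have e : ∀ w : ℝ, 0 < w → (w ^ 2) ^ (p / 2) = w ^ p := by
    intro w hw
    rw [← Real.rpow_natCast_mul hw.le]
    congr 1
    push_cast
    ring
  rw [e u hu, e v hv, sub_mul, sq_mul_rpow_sub_two hv] at h1
  have h2 := sq_mul_rpow_sub_two (p := p) hu
  have h3 : u ^ p ≤ v ^ p := by gcongr
  have h4 : v ^ (p - 2) ≤ u ^ (p - 2) := Real.rpow_le_rpow_of_nonpos hu huv (by linarith)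
  have h5 : t ^ 2 * (u ^ (p - 2) - v ^ (p - 2)) ≤ u ^ 2 * (u ^ (p - 2) - v ^ (p - 2)) :=
    mul_le_mul_of_nonneg_right ht (by linarith)
  nlinarith

/-- Second order Taylor bound for `|x| ^ p`, `p ≥ 2`. -/
theorem abs_rpow_le_taylor {p m x y : ℝ} (hp : 2 ≤ p) (hx : |x| ≤ m) (hy : |y| ≤ m) :
    |y| ^ p ≤ |x| ^ p + p * (x * |x| ^ (p - 2)) * (y - x) +
      p * (p - 1) * ((y - x) ^ 2 * m ^ (p - 2)) := by
  have hm : 0 ≤ m := (abs_nonneg x).trans hx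
  have e : ∀ z : ℝ, |z| * |z| ^ (p - 2) = |z| ^ (p - 1) := fun z => by
    have := mul_rpow_sub_one (abs_nonneg z) (r := p - 1) (by linarith)
    rwa [show p - 1 - 1 = p - 2 by ring] at this
  -- tangent inequality at `y`
  have tangent : |y| ^ p ≤ |x| ^ p + p * (y * |y| ^ (p - 2)) * (y - x) := by
    have h := rpow_tangent_le (abs_nonneg y) (abs_nonneg x) (r := p) (by linarith)
    have h1 : |y| ^ (p - 1) * |x| ≥ (y * |y| ^ (p - 2)) * x := by
      rw [← e y]
      have : y * x ≤ |y| * |x| := by rw [← abs_mul]; exact le_abs_self _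
      have h0 : 0 ≤ |y| ^ (p - 2) := by positivity
      nlinarith
    have h2 : |y| ^ (p - 1) * |y| = (y * |y| ^ (p - 2)) * y := by
      rw [← e y]
      have := abs_mul_abs_self y
      calc |y| * |y| ^ (p - 2) * |y| = (|y| * |y|) * |y| ^ (p - 2) := by ring
        _ = _ := by rw [this]; ring
    nlinarith
  have same : ∀ a b : ℝ, 0 ≤ a → a ≤ b → b ≤ m →
      b * b ^ (p - 2) - a * a ^ (p - 2) ≤ (p - 1) * ((b - a) * m ^ (p - 2)) := by
    intro a b ha hab hb
    have eb := e b
    have ea := e a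
    rw [abs_of_nonneg (ha.trans hab)] at eb
    rw [abs_of_nonneg ha] at ea
    rw [eb, ea]
    have h := rpow_sub_rpow_le ha (ha.trans hab) (r := p - 1) (by linarith)
    rw [show p - 1 - 1 = p - 2 by ring] at h
    refine h.trans ?_
    have h0 : b ^ (p - 2) ≤ m ^ (p - 2) := Real.rpow_le_rpow (ha.trans hab) hb (by linarith)
    exact mul_le_mul_of_nonneg_left (mul_le_mul_of_nonneg_left h0 (by linarith)) (by linarith)
  have opp : ∀ a b : ℝ, 0 ≤ a → 0 ≤ b → a ≤ m → b ≤ m →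
      b * b ^ (p - 2) + a * a ^ (p - 2) ≤ (p - 1) * ((b + a) * m ^ (p - 2)) := by
    intro a b ha hb ham hbm
    have ha' : a ^ (p - 2) ≤ m ^ (p - 2) := Real.rpow_le_rpow ha ham (by linarith)
    have hb' : b ^ (p - 2) ≤ m ^ (p - 2) := Real.rpow_le_rpow hb hbm (by linarith)
    have hm' : 0 ≤ m ^ (p - 2) := Real.rpow_nonneg hm _
    have : b * b ^ (p - 2) + a * a ^ (p - 2) ≤ (b + a) * m ^ (p - 2) := by nlinarith
    have h0 : 0 ≤ (b + a) * m ^ (p - 2) := by positivity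
    nlinarith
  -- The tangent at `y` has slope `p * φ y` with `φ t = t * |t| ^ (p - 2)`. Moving the slope to `x`
  -- costs `(φ y - φ x) * (y - x)`, and `φ` has Lipschitz constant `(p - 1) * m ^ (p - 2)` on `[-m,
  -- m]`: `same` and `opp` treat points of equal and of opposite sign.
  have mono : (y * |y| ^ (p - 2) - x * |x| ^ (p - 2)) * (y - x) ≤
      (p - 1) * ((y - x) ^ 2 * m ^ (p - 2)) := by
    rcases le_total 0 x with h0x | h0x <;> rcases le_total 0 y with h0y | h0y
    · rw [abs_of_nonneg h0x] at *
      rw [abs_of_nonneg h0y] at *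
      rcases le_total x y with h | h
      · nlinarith [same x y h0x h hy]
      · nlinarith [same y x h0y h hx]
    · rw [abs_of_nonneg h0x] at *
      rw [abs_of_nonpos h0y] at *
      nlinarith [opp x (-y) h0x (by linarith) hx hy]
    · rw [abs_of_nonpos h0x] at *
      rw [abs_of_nonneg h0y] at *
      nlinarith [opp (-x) y (by linarith) h0y hx hy]
    · rw [abs_of_nonpos h0x] at *
      rw [abs_of_nonpos h0y] at *
      rcases le_total x y with h | h
      · nlinarith [same (-y) (-x) (by linarith) (by linarith) hx]
      · nlinarith [same (-x) (-y) (by linarith) (by linarith) hy]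
  nlinarith

end

/-! ### Martingales on a unit interval and Doob's inequality -/

section

/-- Martingales on a unit interval, in terms of orthogonality relations. -/
structure IsLevelMartingale (μ : Measure ℝ) (f : ℕ → ℝ → ℝ) : Prop where
  level : ∀ n, LevelConst n (f n)
  orth : ∀ n ξ, LevelConst n ξ → ∫ x, ξ x * (f (n + 1) x - f n x) ∂μ = 0

/-- `a n` is a version of the conditional expectation of `|f (n + 1) - f n| ^ 2` given level `n`. -/
structure IsCondSquare (μ : Measure ℝ) (f a : ℕ → ℝ → ℝ) : Prop where
  level : ∀ n, LevelConst n (a n)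
  nonneg : ∀ n x, 0 ≤ a n x
  orth : ∀ n ξ, LevelConst n ξ →
    ∫ x, ξ x * (f (n + 1) x - f n x) ^ 2 ∂μ = ∫ x, ξ x * a n x ∂μ

/-- The running maximum of `|f k|`, `k ≤ n`. -/
noncomputable def runMax (f : ℕ → ℝ → ℝ) : ℕ → ℝ → ℝ
  | 0, x => |f 0 x|
  | n + 1, x => max (runMax f n x) |f (n + 1) x|

/-- The sum of the squares of the first `n` increments. -/
noncomputable def sqSum (f : ℕ → ℝ → ℝ) (n : ℕ) (x : ℝ) : ℝ :=
  ∑ i ∈ Finset.range n, (f (i + 1) x - f i x) ^ 2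

variable {f a : ℕ → ℝ → ℝ} {P : Measure ℝ} [IsFiniteMeasure P] {j : ℤ} {p r : ℝ}

theorem runMax_nonneg (f : ℕ → ℝ → ℝ) (n : ℕ) (x : ℝ) : 0 ≤ runMax f n x := by
  cases n with
  | zero => exact abs_nonneg _
  | succ n => exact le_max_of_le_right (abs_nonneg _)

theorem abs_le_runMax (f : ℕ → ℝ → ℝ) {k n : ℕ} (h : k ≤ n) (x : ℝ) :
    |f k x| ≤ runMax f n x := by
  induction n with
  | zero => rw [Nat.le_zero.1 h]; rfl
  | succ n ih =>
    rcases Nat.le_succ_iff.1 h with h | rfl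
    · exact (ih h).trans (le_max_left _ _)
    · exact le_max_right _ _

theorem runMax_le {n : ℕ} {x c : ℝ} (h : ∀ k ≤ n, |f k x| ≤ c) : runMax f n x ≤ c := by
  induction n with
  | zero => exact h 0 le_rfl
  | succ n ih => exact max_le (ih fun k hk => h k (hk.trans n.le_succ)) (h _ le_rfl)

theorem runMax_level (hf : ∀ n, LevelConst n (f n)) (n : ℕ) : LevelConst n (runMax f n) := by
  induction n with
  | zero => exact (hf 0).comp abs
  | succ n ih =>
    intro x y e
    simp only [runMax, hf (n + 1) e, ih.mono n.le_succ e]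

theorem sqSum_nonneg (f : ℕ → ℝ → ℝ) (n : ℕ) (x : ℝ) : 0 ≤ sqSum f n x :=
  Finset.sum_nonneg fun _ _ => sq_nonneg _

theorem sqSum_succ (f : ℕ → ℝ → ℝ) (n : ℕ) (x : ℝ) :
    sqSum f (n + 1) x = sqSum f n x + (f (n + 1) x - f n x) ^ 2 :=
  Finset.sum_range_succ _ _

theorem sqSum_le_succ (f : ℕ → ℝ → ℝ) (n : ℕ) (x : ℝ) : sqSum f n x ≤ sqSum f (n + 1) x := by
  rw [sqSum_succ]
  linarith [sq_nonneg (f (n + 1) x - f n x)]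

theorem diff_level (hf : ∀ n, LevelConst n (f n)) {n m : ℕ} (h : n + 1 ≤ m) :
    LevelConst m (fun x => f (n + 1) x - f n x) :=
  fun x y e => by simp only [(hf (n + 1)).mono h e, (hf n).mono (n.le_succ.trans h) e]

theorem sqSum_level (hf : ∀ n, LevelConst n (f n)) (n : ℕ) : LevelConst n (sqSum f n) :=
  LevelConst.sum fun _ hi =>
    (diff_level hf (Finset.mem_range.1 hi)).comp (fun t => t ^ 2)

theorem LevelConst.mul {n : ℕ} {g h : ℝ → ℝ} (hg : LevelConst n g) (hh : LevelConst n h) :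
    LevelConst n (fun x => g x * h x) :=
  hg.comp₂ hh fun s t => s * t

theorem LevelConst.add {n : ℕ} {g h : ℝ → ℝ} (hg : LevelConst n g) (hh : LevelConst n h) :
    LevelConst n (fun x => g x + h x) :=
  hg.comp₂ hh fun s t => s + t

theorem LevelConst.rpow {n : ℕ} {g : ℝ → ℝ} (hg : LevelConst n g) (s : ℝ) :
    LevelConst n (fun x => g x ^ s) :=
  hg.comp fun t => t ^ s

/-- A pathwise form of Doob's inequality. When the maximum does not move, neither side changes; when
it jumps from `u` to `v`, the claim is the tangent inequality for `t ^ p` at `u`. The subtracted sum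
has non-negative integral because `|f|` is a submartingale. -/
theorem runMax_rpow_le (f : ℕ → ℝ → ℝ) (hp : 1 < p) (N : ℕ) (x : ℝ) :
    (p - 1) / p * runMax f N x ^ p ≤ |f N x| * runMax f N x ^ (p - 1) -
      ∑ n ∈ Finset.range N, runMax f n x ^ (p - 1) * (|f (n + 1) x| - |f n x|) := by
  have hp0 : 0 < p := by linarith
  induction N with
  | zero =>
    have e := mul_rpow_sub_one (abs_nonneg (f 0 x)) hp.le
    have h0 : 0 ≤ |f 0 x| ^ p := by positivity
    simp only [runMax, Finset.range_zero, Finset.sum_empty, sub_zero, e]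
    rw [div_mul_eq_mul_div, div_le_iff₀ hp0]
    nlinarith
  | succ N ih =>
    rw [Finset.sum_range_succ]
    set u := runMax f N x with hu
    have hu0 : 0 ≤ u := runMax_nonneg f N x
    have hs : runMax f (N + 1) x = max u |f (N + 1) x| := rfl
    rw [hs]
    rcases le_total |f (N + 1) x| u with h | h
    · rw [max_eq_left h]
      nlinarith
    · rw [max_eq_right h]
      have t := rpow_tangent_le hu0 (abs_nonneg (f (N + 1) x)) hp.le
      have e1 := mul_rpow_sub_one hu0 hp.le
      have e2 := mul_rpow_sub_one (abs_nonneg (f (N + 1) x)) hp.le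
      set v := |f (N + 1) x|
      have key : (p - 1) / p * v ^ p - (p - 1) / p * u ^ p ≤ v ^ p - v * u ^ (p - 1) := by
        rw [← mul_sub, div_mul_eq_mul_div, div_le_iff₀ hp0]
        nlinarith
      nlinarith

/-- The submartingale property of `|f|`, from testing the martingale with `ξ` times the sign of `f
n`. -/
theorem integral_mul_abs_diff_nonneg (hf : IsLevelMartingale (unitRestrict P j) f) {n : ℕ}
    {ξ : ℝ → ℝ} (hξ : LevelConst n ξ) (hξ0 : ∀ x, 0 ≤ ξ x) :
    0 ≤ ∫ x, ξ x * (|f (n + 1) x| - |f n x|) ∂(unitRestrict P j) := by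
  have h := hf.orth n (fun x => ξ x * SignType.sign (f n x))
    (hξ.mul ((hf.level n).comp fun t => ((SignType.sign t : SignType) : ℝ)))
  rw [← h]
  have L := hξ.mono n.le_succ
  have L1 := (hf.level n).mono n.le_succ
  have L2 := hf.level (n + 1)
  refine integral_mono (LevelConst.integrable (n := n + 1) ?_)
    (LevelConst.integrable (n := n + 1) ?_) fun x => ?_
  · intro x y e; simp only [L e, L1 e, L2 e]
  · intro x y e; simp only [L e, L1 e, L2 e]
  · rw [mul_assoc]
    refine mul_le_mul_of_nonneg_left ?_ (hξ0 x)
    have h1 : (SignType.sign (f n x) : ℝ) * f n x = |f n x| := sign_mul_self _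
    have h2 : (SignType.sign (f n x) : ℝ) * f (n + 1) x ≤ |f (n + 1) x| := by
      rcases lt_trichotomy (f n x) 0 with h | h | h
      · simp only [sign_neg h, SignType.coe_neg_one]
        linarith [neg_abs_le (f (n + 1) x)]
      · simp [h]
      · simp only [sign_pos h, SignType.coe_one]
        linarith [le_abs_self (f (n + 1) x)]
    rw [mul_sub, h1]
    linarith

/-- Doob's maximal inequality. -/
theorem doob (hp : 1 < p) : ∃ C : ℝ, 0 < C ∧ ∀ (P : Measure ℝ) [IsFiniteMeasure P] (j : ℤ)
    (f : ℕ → ℝ → ℝ), IsLevelMartingale (unitRestrict P j) f → ∀ N,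
      ∫ x, runMax f N x ^ p ∂(unitRestrict P j) ≤ C * ∫ x, |f N x| ^ p ∂(unitRestrict P j) := by
  have hp0 : 0 < p := by linarith
  have hp1 : 0 < p - 1 := by linarith
  set c := p / (p - 1) with hc
  have hc0 : 0 < c := by positivity
  -- The constant of `mul_rpow_sub_one_le`, doubled because half of the left side is absorbed.
  refine ⟨2 * (c * (2 * c) ^ (p - 1)), by positivity, fun P _ j f hf N => ?_⟩
  have LM := runMax_level hf.level
  have hsum : LevelConst N (fun x => ∑ n ∈ Finset.range N,
      runMax f n x ^ (p - 1) * (|f (n + 1) x| - |f n x|)) := by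
    refine LevelConst.sum fun n hn => ?_
    have hn := Finset.mem_range.1 hn
    intro x y e
    simp only [(LM n).mono hn.le e, (hf.level (n + 1)).mono hn e, (hf.level n).mono hn.le e]
  have I1 : LevelConst N (fun x => |f N x| * runMax f N x ^ (p - 1)) :=
    fun x y e => by simp only [LM N e, hf.level N e]
  have IM : LevelConst N (fun x => runMax f N x ^ p) := (LM N).rpow p
  have If : LevelConst N (fun x => |f N x| ^ p) := ((hf.level N).comp abs).rpow p
  have h1 : ∫ x, runMax f N x ^ p ∂(unitRestrict P j) ≤
      ∫ x, (c * (|f N x| * runMax f N x ^ (p - 1)) - c * ∑ n ∈ Finset.range N,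
        runMax f n x ^ (p - 1) * (|f (n + 1) x| - |f n x|)) ∂(unitRestrict P j) := by
    refine integral_mono IM.integrable
      ((I1.integrable.const_mul c).sub (hsum.integrable.const_mul c)) fun x => ?_
    have h := runMax_rpow_le f hp N x
    have e : c * ((p - 1) / p) = 1 := by rw [hc]; field_simp
    have h' := mul_le_mul_of_nonneg_left h hc0.le
    rw [← mul_assoc, e, one_mul, mul_sub] at h'
    exact h'
  rw [integral_sub (I1.integrable.const_mul c) (hsum.integrable.const_mul c), integral_const_mul,
    integral_const_mul, integral_finsetSum] at h1
  swap
  · intro n hn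
    have hn := Finset.mem_range.1 hn
    refine LevelConst.integrable (n := N) fun x y e => ?_
    simp only [(LM n).mono hn.le e, (hf.level (n + 1)).mono hn e, (hf.level n).mono hn.le e]
  have h2 : 0 ≤ ∑ n ∈ Finset.range N, ∫ x, runMax f n x ^ (p - 1) * (|f (n + 1) x| - |f n x|)
      ∂(unitRestrict P j) :=
    Finset.sum_nonneg fun n _ => integral_mul_abs_diff_nonneg hf ((LM n).rpow _)
      fun x => Real.rpow_nonneg (runMax_nonneg _ _ _) _
  have h3 : c * ∫ x, |f N x| * runMax f N x ^ (p - 1) ∂(unitRestrict P j) ≤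
      (∫ x, runMax f N x ^ p ∂(unitRestrict P j)) / 2 +
        c * (2 * c) ^ (p - 1) * ∫ x, |f N x| ^ p ∂(unitRestrict P j) := by
    rw [← integral_const_mul, ← integral_const_mul, ← integral_div, ← integral_add]
    · refine integral_mono (I1.integrable.const_mul c)
        ((IM.integrable.div_const 2).add (If.integrable.const_mul _)) fun x => ?_
      exact mul_rpow_sub_one_le hc0.le (abs_nonneg _) (runMax_nonneg _ _ _) hp.le
    · exact IM.integrable.div_const 2
    · exact If.integrable.const_mul _
  have := mul_nonneg hc0.le h2
  linarith

/-- The square of an increment may be replaced by the increment of the squares. -/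
theorem integral_mul_diff_sq (hf : IsLevelMartingale (unitRestrict P j) f) {n : ℕ} {ξ : ℝ → ℝ}
    (hξ : LevelConst n ξ) :
    ∫ x, ξ x * (f (n + 1) x - f n x) ^ 2 ∂(unitRestrict P j) =
      ∫ x, ξ x * (f (n + 1) x ^ 2 - f n x ^ 2) ∂(unitRestrict P j) := by
  have h := hf.orth n (fun x => ξ x * (2 * f n x)) (hξ.mul ((hf.level n).comp fun t => 2 * t))
  have L := hξ.mono n.le_succ
  have L1 := (hf.level n).mono n.le_succ
  have L2 := hf.level (n + 1)
  rw [← sub_eq_zero, ← integral_sub, ← neg_zero, ← h, ← integral_neg]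
  · congr 1 with x
    ring
  · refine LevelConst.integrable (n := n + 1) fun x y e => ?_
    simp only [L e, L1 e, L2 e]
  · refine LevelConst.integrable (n := n + 1) fun x y e => ?_
    simp only [L e, L1 e, L2 e]

theorem integral_sq_eq_sqSum (hf : IsLevelMartingale (unitRestrict P j) f) (h0 : f 0 = 0)
    (N : ℕ) : ∫ x, f N x ^ 2 ∂(unitRestrict P j) = ∫ x, sqSum f N x ∂(unitRestrict P j) := by
  induction N with
  | zero => simp [h0, sqSum]
  | succ n ih =>
    have L1 := (hf.level n).mono n.le_succ
    have L2 := hf.level (n + 1)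
    have L3 := sqSum_level hf.level n
    have h := integral_mul_diff_sq hf (LevelConst.const n (1 : ℝ))
    simp only [one_mul] at h
    simp only [sqSum_succ]
    rw [integral_add L3.integrable ((diff_level hf.level le_rfl).comp fun t => t ^ 2).integrable, h,
      ← ih, integral_sub (L2.comp fun t => t ^ 2).integrable (L1.comp fun t => t ^ 2).integrable]
    ring

end

/-! ### Weighted sums of squares, `p ≤ 2` -/

section

variable {f a W : ℕ → ℝ → ℝ} {P : Measure ℝ} [IsFiniteMeasure P] {j : ℤ} {p r : ℝ}

/-- Positive adapted non-decreasing sequences. -/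
structure IsWeight (W : ℕ → ℝ → ℝ) : Prop where
  level : ∀ n, LevelConst n (W n)
  pos : ∀ n x, 0 < W n x
  mono : ∀ x, Monotone fun n => W n x

/-- The sum of the squares of the first `N + 1` increments of `f`, with weights `W i ^ s`. -/
noncomputable def weightedSqSum (f W : ℕ → ℝ → ℝ) (s : ℝ) (N : ℕ) (x : ℝ) : ℝ :=
  ∑ i ∈ Finset.range (N + 1), W i x ^ s * (f (i + 1) x - f i x) ^ 2

theorem weightedSqSum_term_level (hf : ∀ n, LevelConst n (f n)) (hW : ∀ n, LevelConst n (W n))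
    (s : ℝ) {i N : ℕ} (hi : i ∈ Finset.range (N + 1)) :
    LevelConst (N + 1) (fun x => W i x ^ s * (f (i + 1) x - f i x) ^ 2) := by
  have hi := Finset.mem_range.1 hi
  intro x y e
  simp only [(hW i).mono hi.le e, diff_level hf hi e]

theorem weightedSqSum_level (hf : ∀ n, LevelConst n (f n)) (hW : ∀ n, LevelConst n (W n))
    (s : ℝ) (N : ℕ) : LevelConst (N + 1) (weightedSqSum f W s N) :=
  LevelConst.sum fun _ hi => weightedSqSum_term_level hf hW s hi

theorem integral_weightedSqSum (hf : ∀ n, LevelConst n (f n)) (hW : ∀ n, LevelConst n (W n))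
    (s : ℝ) (N : ℕ) : ∫ x, weightedSqSum f W s N x ∂(unitRestrict P j) =
      ∑ i ∈ Finset.range (N + 1),
        ∫ x, W i x ^ s * (f (i + 1) x - f i x) ^ 2 ∂(unitRestrict P j) :=
  integral_finsetSum _ fun _ hi => (weightedSqSum_term_level hf hW s hi).integrable

/-- The weight `W i` has the level of `a i`, so it is an admissible test function for exchanging the
squared increment with `a i`. -/
theorem integral_weightedSqSum_eq_cond (hf : ∀ n, LevelConst n (f n))
    (ha : IsCondSquare (unitRestrict P j) f a) (hW : ∀ n, LevelConst n (W n)) (s : ℝ) (N : ℕ) :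
    ∫ x, weightedSqSum f W s N x ∂(unitRestrict P j) =
      ∫ x, ∑ i ∈ Finset.range (N + 1), W i x ^ s * a i x ∂(unitRestrict P j) := by
  rw [integral_weightedSqSum hf hW, integral_finsetSum]
  · exact Finset.sum_congr rfl fun i _ => ha.orth i _ ((hW i).rpow s)
  · exact fun i _ => (((hW i).rpow s).mul (ha.level i)).integrable

theorem integral_weightedSqSum_eq_diff (hf : IsLevelMartingale (unitRestrict P j) f)
    (hW : ∀ n, LevelConst n (W n)) (s : ℝ) (N : ℕ) :
    ∫ x, weightedSqSum f W s N x ∂(unitRestrict P j) =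
      ∫ x, ∑ i ∈ Finset.range (N + 1), W i x ^ s * (f (i + 1) x ^ 2 - f i x ^ 2)
        ∂(unitRestrict P j) := by
  rw [integral_weightedSqSum hf.level hW, integral_finsetSum]
  · exact Finset.sum_congr rfl fun i _ => integral_mul_diff_sq hf ((hW i).rpow s)
  · intro i _
    refine LevelConst.integrable (n := i + 1) fun x y e => ?_
    simp only [(hW i).mono i.le_succ e, (hf.level i).mono i.le_succ e, hf.level (i + 1) e]

theorem sum_mul_rpow_le {b : ℕ → ℝ} (hb : ∀ i, 0 ≤ b i) (hW : IsWeight W) {s : ℝ} (hs : s ≤ 0)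
    (N : ℕ) (x : ℝ) : (∑ i ∈ Finset.range (N + 1), b i) * W N x ^ s ≤
      ∑ i ∈ Finset.range (N + 1), W i x ^ s * b i := by
  rw [Finset.sum_mul]
  refine Finset.sum_le_sum fun i hi => ?_
  rw [mul_comm]
  exact mul_le_mul_of_nonneg_right (Real.rpow_le_rpow_of_nonpos (hW.pos i x)
    (hW.mono x (Nat.lt_succ_iff.1 (Finset.mem_range.1 hi))) hs) (hb i)

theorem integral_sqSum_rpow_le_weighted (hp : 0 < p) (hp2 : p ≤ 2)
    (hf : ∀ n, LevelConst n (f n)) (hW : IsWeight W) (N : ℕ) :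
    ∫ x, sqSum f (N + 1) x ^ (p / 2) ∂(unitRestrict P j) ≤
      ∫ x, weightedSqSum f W (p - 2) N x ∂(unitRestrict P j) +
        ∫ x, W N x ^ p ∂(unitRestrict P j) := by
  have I1 := (weightedSqSum_level hf hW.level (p - 2) N).integrable (P := P) (j := j)
  have I2 := ((hW.level N).rpow p).integrable (P := P) (j := j)
  rw [← integral_add I1 I2]
  refine integral_mono ((sqSum_level hf (N + 1)).rpow _).integrable (I1.add I2) fun x => ?_
  refine (rpow_half_le hp hp2 (sqSum_nonneg f _ x) (hW.pos N x)).trans ?_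
  exact add_le_add_left (sum_mul_rpow_le (fun _ => sq_nonneg _) hW (by linarith) N x) _

theorem integral_condSum_rpow_le_weighted (hp : 0 < p) (hp2 : p ≤ 2)
    (hf : ∀ n, LevelConst n (f n)) (ha : IsCondSquare (unitRestrict P j) f a) (hW : IsWeight W)
    (N : ℕ) :
    ∫ x, (∑ i ∈ Finset.range (N + 1), a i x) ^ (p / 2) ∂(unitRestrict P j) ≤
      ∫ x, weightedSqSum f W (p - 2) N x ∂(unitRestrict P j) +
        ∫ x, W N x ^ p ∂(unitRestrict P j) := by
  rw [integral_weightedSqSum_eq_cond hf ha hW.level]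
  have L1 : LevelConst N fun x => ∑ i ∈ Finset.range (N + 1), W i x ^ (p - 2) * a i x := by
    refine LevelConst.sum fun i hi => ?_
    exact (((hW.level i).rpow _).mul (ha.level i)).mono (Nat.lt_succ_iff.1 (Finset.mem_range.1 hi))
  have L2 : LevelConst N fun x => ∑ i ∈ Finset.range (N + 1), a i x :=
    LevelConst.sum fun i hi => (ha.level i).mono (Nat.lt_succ_iff.1 (Finset.mem_range.1 hi))
  have I1 := L1.integrable (P := P) (j := j)
  have I2 := ((hW.level N).rpow p).integrable (P := P) (j := j)
  rw [← integral_add I1 I2]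
  refine integral_mono (L2.rpow _).integrable (I1.add I2) fun x => ?_
  refine (rpow_half_le hp hp2 (Finset.sum_nonneg fun i _ => ha.nonneg i x) (hW.pos N x)).trans ?_
  exact add_le_add_left (sum_mul_rpow_le (fun i => ha.nonneg i x) hW (by linarith) N x) _

/-- The martingale transform of `f` by the predictable sequence `W i ^ s`. -/
noncomputable def weightTransform (f W : ℕ → ℝ → ℝ) (s : ℝ) (n : ℕ) (x : ℝ) : ℝ :=
  ∑ i ∈ Finset.range n, W i x ^ s * (f (i + 1) x - f i x)

theorem weightTransform_diff (f W : ℕ → ℝ → ℝ) (s : ℝ) (n : ℕ) (x : ℝ) :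
    weightTransform f W s (n + 1) x - weightTransform f W s n x =
      W n x ^ s * (f (n + 1) x - f n x) := by
  rw [weightTransform, weightTransform, Finset.sum_range_succ, add_sub_cancel_left]

theorem weightTransform_martingale {μ : Measure ℝ} (hf : IsLevelMartingale μ f)
    (hW : ∀ n, LevelConst n (W n)) (s : ℝ) :
    IsLevelMartingale μ (weightTransform f W s) where
  level n := LevelConst.sum fun i hi => by
    have hi := Finset.mem_range.1 hi
    exact (((hW i).mono hi.le).rpow s).mul (diff_level hf.level hi)
  orth n ξ hξ := by
    simp only [weightTransform_diff, ← mul_assoc]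
    exact hf.orth n _ (hξ.mul ((hW n).rpow s))

/-- Summation by parts recovers `f` from its transform `g`: `f (n + 1)` is `W n ^ θ * g (n + 1)`
minus a sum of increments of `W ^ θ` times values of `g`. These increments are non-negative and add
up to at most `W n ^ θ`, so both parts are at most `W n ^ θ * G`. -/
theorem runMax_le_weightTransform (hW : IsWeight W) (h0 : f 0 = 0) {θ : ℝ} (hθ : 0 ≤ θ) (N : ℕ)
    (x : ℝ) : runMax f (N + 1) x ≤
      2 * (W N x ^ θ * runMax (weightTransform f W (-θ)) (N + 1) x) := by
  set g := weightTransform f W (-θ)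
  set G := runMax g (N + 1) x
  have hG0 : 0 ≤ G := runMax_nonneg _ _ _
  have hdiff : ∀ n, f (n + 1) x - f n x = W n x ^ θ * (g (n + 1) x - g n x) := by
    intro n
    rw [weightTransform_diff, ← mul_assoc, ← Real.rpow_add (hW.pos n x), add_neg_cancel,
      Real.rpow_zero, one_mul]
  have hWθ : ∀ n, W n x ^ θ ≤ W (n + 1) x ^ θ := fun n =>
    Real.rpow_le_rpow (hW.pos n x).le (hW.mono x n.le_succ) hθ
  have key : ∀ n ≤ N, |f (n + 1) x - W n x ^ θ * g (n + 1) x| ≤ W n x ^ θ * G := by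
    intro n
    induction n with
    | zero =>
      intro _
      have := hdiff 0
      have g0 : g 0 x = 0 := by simp [g, weightTransform]
      rw [g0, h0, Pi.zero_apply, sub_zero, sub_zero] at this
      rw [this, sub_self, abs_zero]
      have := Real.rpow_nonneg (hW.pos 0 x).le θ
      positivity
    | succ n ih =>
      intro hn
      have ih := ih (n.le_succ.trans hn)
      have e : f (n + 1 + 1) x - W (n + 1) x ^ θ * g (n + 1 + 1) x =
          (f (n + 1) x - W n x ^ θ * g (n + 1) x) -
            (W (n + 1) x ^ θ - W n x ^ θ) * g (n + 1) x := by
        have := hdiff (n + 1)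
        linear_combination this
      rw [e]
      refine (abs_sub _ _).trans ?_
      rw [abs_mul, abs_of_nonneg (sub_nonneg.2 (hWθ n))]
      have hg : |g (n + 1) x| ≤ G := abs_le_runMax g (by omega) x
      have := mul_le_mul_of_nonneg_left hg (sub_nonneg.2 (hWθ n))
      linarith
  have hmono : Monotone fun n => W n x ^ θ := monotone_nat_of_le_succ hWθ
  refine runMax_le fun k hk => ?_
  have hWN : 0 ≤ W N x ^ θ := Real.rpow_nonneg (hW.pos N x).le θ
  cases k with
  | zero =>
    rw [h0, Pi.zero_apply, abs_zero]
    positivity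
  | succ k =>
    have hk : k ≤ N := by omega
    have h1 := key k hk
    have hg : |g (k + 1) x| ≤ G := abs_le_runMax g (by omega) x
    have hk0 : 0 ≤ W k x ^ θ := Real.rpow_nonneg (hW.pos k x).le θ
    have h2 : |f (k + 1) x| ≤ W k x ^ θ * G + W k x ^ θ * G := by
      have h3 := abs_add_le (f (k + 1) x - W k x ^ θ * g (k + 1) x) (W k x ^ θ * g (k + 1) x)
      rw [sub_add_cancel, abs_mul (W k x ^ θ), abs_of_nonneg hk0] at h3
      have := mul_le_mul_of_nonneg_left hg hk0
      linarith
    have h4 := mul_le_mul_of_nonneg_right (hmono hk) hG0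
    simp only at h4
    linarith

/-- With `θ = (2 - p) / 2` the squared increments of the transform are exactly the terms of
`weightedSqSum f W (p - 2)`, so Doob's inequality in `L_2` applies to it. In `rpow_half_le` the
factor `W ^ (2 * θ)` from the summation by parts cancels `W ^ (p - 2)`, and the square of its
constant `2` gives the factor `4`. -/
theorem exists_integral_runMax_rpow_le_weighted (hp : 0 < p) (hp2 : p ≤ 2) :
    ∃ C : ℝ, 0 < C ∧ ∀ (P : Measure ℝ) [IsFiniteMeasure P] (j : ℤ) (f W : ℕ → ℝ → ℝ),
      IsLevelMartingale (unitRestrict P j) f → f 0 = 0 → IsWeight W → ∀ N,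
      ∫ x, runMax f (N + 1) x ^ p ∂(unitRestrict P j) ≤
        C * ∫ x, weightedSqSum f W (p - 2) N x ∂(unitRestrict P j) +
          ∫ x, W N x ^ p ∂(unitRestrict P j) := by
  obtain ⟨D, hD, hdoob⟩ := doob (p := 2) (by norm_num)
  refine ⟨4 * D, by positivity, fun P _ j f W hf h0 hW N => ?_⟩
  set θ := (2 - p) / 2 with hθ
  have hθ0 : 0 ≤ θ := by rw [hθ]; linarith
  have hg := weightTransform_martingale hf hW.level (-θ)
  have g0 : weightTransform f W (-θ) 0 = 0 := by ext x; simp [weightTransform]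
  have h1 := hdoob P j _ hg (N + 1)
  have h2 := integral_sq_eq_sqSum hg g0 (N + 1)
  have h3 : ∀ x, sqSum (weightTransform f W (-θ)) (N + 1) x = weightedSqSum f W (p - 2) N x := by
    intro x
    refine Finset.sum_congr rfl fun i _ => ?_
    rw [weightTransform_diff, mul_pow, ← Real.rpow_mul_natCast (hW.pos i x).le]
    congr 2
    rw [hθ]
    push_cast
    ring
  simp only [Real.rpow_ofNat, sq_abs, h2, h3] at h1
  have LG := (runMax_level hg.level (N + 1)).comp fun t => t ^ 2
  have I1 := LG.integrable (P := P) (j := j)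
  have I2 := ((hW.level N).rpow p).integrable (P := P) (j := j)
  have h4 : ∫ x, runMax f (N + 1) x ^ p ∂(unitRestrict P j) ≤
      ∫ x, (4 * runMax (weightTransform f W (-θ)) (N + 1) x ^ 2 + W N x ^ p)
        ∂(unitRestrict P j) := by
    refine integral_mono ((runMax_level hf.level (N + 1)).rpow _).integrable
      ((I1.const_mul 4).add I2) fun x => ?_
    have hM := runMax_nonneg f (N + 1) x
    have hb := runMax_le_weightTransform hW h0 hθ0 N x
    have hr := rpow_half_le (q := runMax f (N + 1) x ^ 2) hp hp2 (by positivity) (hW.pos N x)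
    rw [← Real.rpow_natCast_mul hM, Nat.cast_ofNat, mul_div_cancel₀ p two_ne_zero] at hr
    refine hr.trans (add_le_add_left ?_ _)
    have hw := hW.pos N x
    have e : (W N x ^ θ) ^ 2 * W N x ^ (p - 2) = 1 := by
      rw [← Real.rpow_mul_natCast hw.le, ← Real.rpow_add hw, hθ]
      convert Real.rpow_zero _ using 2
      push_cast
      ring
    calc runMax f (N + 1) x ^ 2 * W N x ^ (p - 2)
        ≤ (2 * (W N x ^ θ * runMax (weightTransform f W (-θ)) (N + 1) x)) ^ 2 *
          W N x ^ (p - 2) := by gcongr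
      _ = 4 * runMax (weightTransform f W (-θ)) (N + 1) x ^ 2 *
          ((W N x ^ θ) ^ 2 * W N x ^ (p - 2)) := by ring
      _ = _ := by rw [e, mul_one]
  rw [integral_add (I1.const_mul 4) I2, integral_const_mul] at h4
  linarith

/-- By `sub_mul_rpow_le`, each term `W i ^ (p - 2) * a i` is at most `2 / p` times the increment of
the `p / 2`-th power of the partial sums, and these increments telescope. -/
theorem integral_weightedSqSum_le_of_condSum_le (hp : 0 < p) (hp2 : p ≤ 2)
    (hf : ∀ n, LevelConst n (f n)) (ha : IsCondSquare (unitRestrict P j) f a) (hW : IsWeight W)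
    (h : ∀ n x, ∑ i ∈ Finset.range (n + 1), a i x ≤ W n x ^ 2) (N : ℕ) :
    ∫ x, weightedSqSum f W (p - 2) N x ∂(unitRestrict P j) ≤
      2 / p * ∫ x, W N x ^ p ∂(unitRestrict P j) := by
  rw [integral_weightedSqSum_eq_cond hf ha hW.level, ← integral_const_mul]
  refine integral_mono (LevelConst.integrable (n := N) (LevelConst.sum fun i hi => ?_))
    (((hW.level N).rpow p).integrable.const_mul _) fun x => ?_
  · exact (((hW.level i).rpow _).mul (ha.level i)).mono (Nat.lt_succ_iff.1 (Finset.mem_range.1 hi))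
  · have h0 : ∀ n, 0 ≤ ∑ i ∈ Finset.range n, a i x := fun n =>
      Finset.sum_nonneg fun i _ => ha.nonneg i x
    calc ∑ i ∈ Finset.range (N + 1), W i x ^ (p - 2) * a i x
        ≤ ∑ i ∈ Finset.range (N + 1), (2 / p * (∑ k ∈ Finset.range (i + 1), a k x) ^ (p / 2) -
          2 / p * (∑ k ∈ Finset.range i, a k x) ^ (p / 2)) := by
          refine Finset.sum_le_sum fun i _ => ?_
          have := sub_mul_rpow_le hp hp2 (h0 i) (v := ∑ k ∈ Finset.range (i + 1), a k x)
            (by rw [Finset.sum_range_succ]; linarith [ha.nonneg i x]) (hW.pos i x) (h i x)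
          rw [Finset.sum_range_succ, add_sub_cancel_left] at this
          rw [Finset.sum_range_succ]
          linarith
      _ = 2 / p * (∑ k ∈ Finset.range (N + 1), a k x) ^ (p / 2) := by
          rw [Finset.sum_range_sub (fun i => 2 / p * (∑ k ∈ Finset.range i, a k x) ^ (p / 2))]
          rw [Finset.range_zero, Finset.sum_empty, Real.zero_rpow (by positivity)]
          ring
      _ ≤ 2 / p * W N x ^ p := by
          have : (∑ k ∈ Finset.range (N + 1), a k x) ^ (p / 2) ≤ (W N x ^ 2) ^ (p / 2) :=
            Real.rpow_le_rpow (h0 _) (h N x) (by positivity)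
          rw [← Real.rpow_natCast_mul (hW.pos N x).le, Nat.cast_ofNat,
            mul_div_cancel₀ p two_ne_zero] at this
          gcongr

theorem integral_weightedSqSum_le_of_sqSum_le (hp : 0 < p) (hp2 : p ≤ 2)
    (hf : ∀ n, LevelConst n (f n)) (hW : IsWeight W)
    (h : ∀ᵐ x ∂(unitRestrict P j), ∀ n, sqSum f (n + 1) x ≤ W n x ^ 2) (N : ℕ) :
    ∫ x, weightedSqSum f W (p - 2) N x ∂(unitRestrict P j) ≤
      2 / p * ∫ x, W N x ^ p ∂(unitRestrict P j) := by
  rw [← integral_const_mul]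
  refine integral_mono_ae (weightedSqSum_level hf hW.level _ N).integrable
    (((hW.level N).rpow p).integrable.const_mul _) ?_
  filter_upwards [h] with x h
  calc weightedSqSum f W (p - 2) N x
      ≤ ∑ i ∈ Finset.range (N + 1), (2 / p * sqSum f (i + 1) x ^ (p / 2) -
        2 / p * sqSum f i x ^ (p / 2)) := by
        refine Finset.sum_le_sum fun i _ => ?_
        have := sub_mul_rpow_le hp hp2 (sqSum_nonneg f i x) (sqSum_le_succ f i x) (hW.pos i x) (h i)
        rw [sqSum_succ, add_sub_cancel_left] at this
        rw [sqSum_succ]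
        linarith
    _ = 2 / p * sqSum f (N + 1) x ^ (p / 2) := by
        rw [Finset.sum_range_sub (fun i => 2 / p * sqSum f i x ^ (p / 2))]
        rw [sqSum, sqSum, Finset.range_zero, Finset.sum_empty, Real.zero_rpow (by positivity)]
        ring
    _ ≤ 2 / p * W N x ^ p := by
        have : sqSum f (N + 1) x ^ (p / 2) ≤ (W N x ^ 2) ^ (p / 2) :=
          Real.rpow_le_rpow (sqSum_nonneg _ _ _) (h N) (by positivity)
        rw [← Real.rpow_natCast_mul (hW.pos N x).le, Nat.cast_ofNat,
          mul_div_cancel₀ p two_ne_zero] at this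
        gcongr

/-- Once squared increments become increments of `f ^ 2`, summation by parts leaves a boundary term,
at most `W N ^ p`, and decrements of the weight, which `sq_mul_rpow_sub_le` pays for by `2 / p`
times increments of `W ^ p`. -/
theorem integral_weightedSqSum_le_of_abs_le (hp : 0 < p) (hp2 : p ≤ 2)
    (hf : IsLevelMartingale (unitRestrict P j) f) (h0 : f 0 = 0) (hW : IsWeight W)
    (h : ∀ᵐ x ∂(unitRestrict P j), ∀ n, f (n + 1) x ^ 2 ≤ W n x ^ 2) (N : ℕ) :
    ∫ x, weightedSqSum f W (p - 2) N x ∂(unitRestrict P j) ≤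
      (1 + 2 / p) * ∫ x, W N x ^ p ∂(unitRestrict P j) := by
  rw [integral_weightedSqSum_eq_diff hf hW.level, ← integral_const_mul]
  refine integral_mono_ae (LevelConst.integrable (n := N + 1) (LevelConst.sum fun i hi => ?_))
    (((hW.level N).rpow p).integrable.const_mul _) ?_
  · have hi := Finset.mem_range.1 hi
    intro x y e
    simp only [(hW.level i).mono hi.le e, (hf.level i).mono hi.le e, (hf.level (i + 1)).mono hi e]
  filter_upwards [h] with x h
  have key : ∀ N, ∑ i ∈ Finset.range (N + 1), W i x ^ (p - 2) * (f (i + 1) x ^ 2 - f i x ^ 2) ≤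
      W N x ^ (p - 2) * f (N + 1) x ^ 2 + 2 / p * W N x ^ p := by
    intro N
    induction N with
    | zero =>
      have : 0 ≤ W 0 x ^ p := Real.rpow_nonneg (hW.pos 0 x).le p
      have : 0 ≤ 2 / p * W 0 x ^ p := by positivity
      simp [h0, this]
    | succ N ih =>
      rw [Finset.sum_range_succ]
      have := sq_mul_rpow_sub_le hp hp2 (hW.pos N x) (hW.mono x N.le_succ) (h N)
      linarith
  refine (key N).trans ?_
  have h1 := sq_mul_rpow_sub_two (p := p) (hW.pos N x)
  have h2 := mul_le_mul_of_nonneg_left (h N) (Real.rpow_nonneg (hW.pos N x).le (p - 2))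
  linarith

end

/-! ### Inequalities for `p ≥ 2` -/

section

variable {f a W : ℕ → ℝ → ℝ} {P : Measure ℝ} [IsFiniteMeasure P] {j : ℤ} {p r : ℝ}

theorem sq_rpow_half {t : ℝ} (ht : 0 ≤ t) (p : ℝ) : (t ^ 2) ^ (p / 2) = t ^ p := by
  rw [← Real.rpow_natCast_mul ht, Nat.cast_ofNat, mul_div_cancel₀ p two_ne_zero]

/-- A form of Young's inequality that absorbs the left-hand side. -/
theorem integral_rpow_le_of_le_mul {X Y : ℝ → ℝ} {c : ℝ} {N : ℕ} (hr : 1 ≤ r) (hc : 0 ≤ c)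
    (hX : LevelConst N X) (hY : LevelConst N Y) (hX0 : ∀ x, 0 ≤ X x) (hY0 : ∀ x, 0 ≤ Y x)
    (h : ∫ x, Y x ^ r ∂(unitRestrict P j) ≤ c * ∫ x, X x * Y x ^ (r - 1) ∂(unitRestrict P j)) :
    ∫ x, Y x ^ r ∂(unitRestrict P j) ≤
      2 * (c * (2 * c) ^ (r - 1)) * ∫ x, X x ^ r ∂(unitRestrict P j) := by
  have IY := (hY.rpow r).integrable (P := P) (j := j)
  have IX := (hX.rpow r).integrable (P := P) (j := j)
  have h3 : c * ∫ x, X x * Y x ^ (r - 1) ∂(unitRestrict P j) ≤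
      (∫ x, Y x ^ r ∂(unitRestrict P j)) / 2 +
        c * (2 * c) ^ (r - 1) * ∫ x, X x ^ r ∂(unitRestrict P j) := by
    rw [← integral_const_mul, ← integral_const_mul, ← integral_div,
      ← integral_add (IY.div_const 2) (IX.const_mul _)]
    refine integral_mono ((hX.mul (hY.rpow _)).integrable.const_mul c)
      ((IY.div_const 2).add (IX.const_mul _)) fun x => ?_
    exact mul_rpow_sub_one_le hc (hX0 x) (hY0 x) hr
  linarith

/-- The tangent is taken at the later partial sum. That sum contains `b i`, which is harmless for
conditional squares: it is still of level `i`. -/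
theorem sum_rpow_le_telescope {b : ℕ → ℝ} (hb : ∀ i, 0 ≤ b i) (hr : 1 ≤ r) (N : ℕ) :
    (∑ i ∈ Finset.range N, b i) ^ r ≤
      r * ∑ i ∈ Finset.range N, (∑ k ∈ Finset.range (i + 1), b k) ^ (r - 1) * b i := by
  have h0 : ∀ n, 0 ≤ ∑ i ∈ Finset.range n, b i := fun n => Finset.sum_nonneg fun i _ => hb i
  induction N with
  | zero => simp [Real.zero_rpow (by linarith : r ≠ 0)]
  | succ N ih =>
    rw [Finset.sum_range_succ (fun i => (∑ k ∈ Finset.range (i + 1), b k) ^ (r - 1) * b i), mul_add]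
    have := rpow_sub_rpow_le (h0 N) (h0 (N + 1)) hr
    have e : ∑ i ∈ Finset.range (N + 1), b i - ∑ i ∈ Finset.range N, b i = b N := by
      rw [Finset.sum_range_succ, add_sub_cancel_left]
    rw [e, mul_comm (b N)] at this
    linarith

theorem weightedSqSum_le_mul (hW0 : ∀ n x, 0 ≤ W n x) (hWm : ∀ x, Monotone fun n => W n x)
    {s : ℝ} (hs : 0 ≤ s) (N : ℕ) (x : ℝ) :
    weightedSqSum f W s N x ≤ sqSum f (N + 1) x * W N x ^ s := by
  rw [sqSum, Finset.sum_mul]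
  refine Finset.sum_le_sum fun i hi => ?_
  rw [mul_comm]
  exact mul_le_mul_of_nonneg_left (Real.rpow_le_rpow (hW0 i x)
    (hWm x (Nat.lt_succ_iff.1 (Finset.mem_range.1 hi))) hs) (sq_nonneg _)

/-- For non-decreasing weights, summation by parts of the increments of `f ^ 2` leaves the last term
minus non-negative terms. -/
theorem integral_weightedSqSum_le_last (hf : IsLevelMartingale (unitRestrict P j) f)
    (h0 : f 0 = 0) (hW : ∀ n, LevelConst n (W n)) (hW0 : ∀ n x, 0 ≤ W n x)
    (hWm : ∀ x, Monotone fun n => W n x) {s : ℝ} (hs : 0 ≤ s) (N : ℕ) :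
    ∫ x, weightedSqSum f W s N x ∂(unitRestrict P j) ≤
      ∫ x, f (N + 1) x ^ 2 * W N x ^ s ∂(unitRestrict P j) := by
  rw [integral_weightedSqSum_eq_diff hf hW]
  refine integral_mono (LevelConst.integrable (n := N + 1) (LevelConst.sum fun i hi => ?_))
    (LevelConst.integrable (n := N + 1) ?_) fun x => ?_
  · have hi := Finset.mem_range.1 hi
    intro x y e
    simp only [(hW i).mono hi.le e, (hf.level i).mono hi.le e, (hf.level (i + 1)).mono hi e]
  · intro x y e
    simp only [(hW N).mono N.le_succ e, hf.level (N + 1) e]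
  · induction N with
    | zero => simp [h0, mul_comm]
    | succ N ih =>
      simp only at ih ⊢
      rw [Finset.sum_range_succ]
      have h1 : W N x ^ s ≤ W (N + 1) x ^ s := Real.rpow_le_rpow (hW0 N x) (hWm x N.le_succ) hs
      have h2 := mul_le_mul_of_nonneg_left h1 (sq_nonneg (f (N + 1) x))
      linarith

/-- The partial sums of `a` are predictable weights, so after `sum_rpow_le_telescope` the
conditional squares can be traded for true squares. Both bounds of `s(f)` for `p ≥ 2` start here. -/
theorem integral_condSum_rpow_le_weightedSqSum (hf : IsLevelMartingale (unitRestrict P j) f)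
    (ha : IsCondSquare (unitRestrict P j) f a) (hr : 1 ≤ r) (N : ℕ) :
    ∫ x, (∑ i ∈ Finset.range (N + 1), a i x) ^ r ∂(unitRestrict P j) ≤
      r * ∫ x, weightedSqSum f (fun n x => ∑ i ∈ Finset.range (n + 1), a i x) (r - 1) N x
        ∂(unitRestrict P j) := by
  have L : ∀ N, LevelConst N fun x => ∑ i ∈ Finset.range (N + 1), a i x := fun N =>
    LevelConst.sum fun i hi => (ha.level i).mono (Nat.lt_succ_iff.1 (Finset.mem_range.1 hi))
  rw [integral_weightedSqSum_eq_cond hf.level ha L, ← integral_const_mul]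
  refine integral_mono ((L N).rpow r).integrable (Integrable.const_mul
    (LevelConst.integrable (n := N) (LevelConst.sum fun i hi => ?_)) r) fun x => ?_
  · exact (((L i).rpow _).mul (ha.level i)).mono (Nat.lt_succ_iff.1 (Finset.mem_range.1 hi))
  · exact sum_rpow_le_telescope (fun i => ha.nonneg i x) hr (N + 1)

theorem integral_condSum_rpow_le_sqSum (hf : IsLevelMartingale (unitRestrict P j) f)
    (ha : IsCondSquare (unitRestrict P j) f a) (hr : 1 ≤ r) (N : ℕ) :
    ∫ x, (∑ i ∈ Finset.range (N + 1), a i x) ^ r ∂(unitRestrict P j) ≤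
      2 * (r * (2 * r) ^ (r - 1)) * ∫ x, sqSum f (N + 1) x ^ r ∂(unitRestrict P j) := by
  have L : ∀ N, LevelConst N fun x => ∑ i ∈ Finset.range (N + 1), a i x := fun N =>
    LevelConst.sum fun i hi => (ha.level i).mono (Nat.lt_succ_iff.1 (Finset.mem_range.1 hi))
  have h0 : ∀ n x, 0 ≤ ∑ i ∈ Finset.range (n + 1), a i x := fun n x =>
    Finset.sum_nonneg fun i _ => ha.nonneg i x
  have hm : ∀ x, Monotone fun n => ∑ i ∈ Finset.range (n + 1), a i x := fun x =>
    monotone_nat_of_le_succ fun n => by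
      rw [Finset.sum_range_succ _ (n + 1)]
      linarith [ha.nonneg (n + 1) x]
  refine integral_rpow_le_of_le_mul hr (by linarith) (sqSum_level hf.level (N + 1))
    ((L N).mono N.le_succ) (sqSum_nonneg f _) (h0 N) ?_
  refine (integral_condSum_rpow_le_weightedSqSum hf ha hr N).trans ?_
  refine mul_le_mul_of_nonneg_left (integral_mono (weightedSqSum_level hf.level L _ N).integrable
    ((sqSum_level hf.level (N + 1)).mul (((L N).mono N.le_succ).rpow _)).integrable fun x => ?_)
    (by linarith)
  exact weightedSqSum_le_mul h0 hm (by linarith) N x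

theorem integral_condSum_rpow_le_sq (hf : IsLevelMartingale (unitRestrict P j) f)
    (ha : IsCondSquare (unitRestrict P j) f a) (h0 : f 0 = 0) (hr : 1 ≤ r) (N : ℕ) :
    ∫ x, (∑ i ∈ Finset.range (N + 1), a i x) ^ r ∂(unitRestrict P j) ≤
      2 * (r * (2 * r) ^ (r - 1)) * ∫ x, (f (N + 1) x ^ 2) ^ r ∂(unitRestrict P j) := by
  have L : ∀ N, LevelConst N fun x => ∑ i ∈ Finset.range (N + 1), a i x := fun N =>
    LevelConst.sum fun i hi => (ha.level i).mono (Nat.lt_succ_iff.1 (Finset.mem_range.1 hi))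
  have ha0 : ∀ n x, 0 ≤ ∑ i ∈ Finset.range (n + 1), a i x := fun n x =>
    Finset.sum_nonneg fun i _ => ha.nonneg i x
  have hm : ∀ x, Monotone fun n => ∑ i ∈ Finset.range (n + 1), a i x := fun x =>
    monotone_nat_of_le_succ fun n => by
      rw [Finset.sum_range_succ _ (n + 1)]
      linarith [ha.nonneg (n + 1) x]
  refine integral_rpow_le_of_le_mul hr (by linarith) ((hf.level (N + 1)).comp fun t => t ^ 2)
    ((L N).mono N.le_succ) (fun _ => sq_nonneg _) (ha0 N) ?_
  refine (integral_condSum_rpow_le_weightedSqSum hf ha hr N).trans ?_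
  exact mul_le_mul_of_nonneg_left
    (integral_weightedSqSum_le_last hf h0 L ha0 hm (by linarith) N) (by linarith)

/-- Taylor's bound is summed along the path with `m` the running maximum at time `N`. The linear
terms are increments times functions of the earlier level, so they integrate to zero. -/
theorem integral_abs_rpow_le (hp : 2 ≤ p) (hf : IsLevelMartingale (unitRestrict P j) f)
    (h0 : f 0 = 0) (N : ℕ) :
    ∫ x, |f N x| ^ p ∂(unitRestrict P j) ≤
      p * (p - 1) * ∫ x, sqSum f N x * runMax f N x ^ (p - 2) ∂(unitRestrict P j) := by
  have LM := runMax_level hf.level N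
  have hterm : ∀ n ∈ Finset.range N, LevelConst N
      (fun x => p * (f n x * |f n x| ^ (p - 2)) * (f (n + 1) x - f n x)) := by
    intro n hn x y e
    have hn := Finset.mem_range.1 hn
    simp only [(hf.level n).mono hn.le e, (hf.level (n + 1)).mono hn e]
  have I1 := (LevelConst.sum hterm).integrable (P := P) (j := j)
  have I2 := (((sqSum_level hf.level N).mul (LM.rpow (p - 2))).integrable
    (P := P) (j := j)).const_mul (p * (p - 1))
  have h1 : ∫ x, |f N x| ^ p ∂(unitRestrict P j) ≤
      ∫ x, ((∑ n ∈ Finset.range N, p * (f n x * |f n x| ^ (p - 2)) * (f (n + 1) x - f n x)) +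
        p * (p - 1) * (sqSum f N x * runMax f N x ^ (p - 2))) ∂(unitRestrict P j) := by
    refine integral_mono (((hf.level N).comp abs).rpow p).integrable (I1.add I2) fun x => ?_
    have key : ∀ m ≤ N, |f m x| ^ p ≤
        (∑ n ∈ Finset.range m, p * (f n x * |f n x| ^ (p - 2)) * (f (n + 1) x - f n x)) +
        p * (p - 1) * (sqSum f m x * runMax f N x ^ (p - 2)) := by
      intro m
      induction m with
      | zero => simp [h0, sqSum, Real.zero_rpow (by linarith : p ≠ 0)]
      | succ m ih =>
        intro hm
        have ih := ih (by omega)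
        have t := abs_rpow_le_taylor hp (abs_le_runMax f (by omega : m ≤ N) x)
          (abs_le_runMax f hm x)
        rw [Finset.sum_range_succ, sqSum_succ]
        linarith
    exact key N le_rfl
  rw [integral_add I1 I2, integral_const_mul, integral_finsetSum _
    fun n hn => (hterm n hn).integrable] at h1
  have h2 : ∑ n ∈ Finset.range N,
      ∫ x, p * (f n x * |f n x| ^ (p - 2)) * (f (n + 1) x - f n x) ∂(unitRestrict P j) = 0 :=
    Finset.sum_eq_zero fun n _ => hf.orth n _
      ((hf.level n).comp fun t => p * (t * |t| ^ (p - 2)))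
  rw [h2, zero_add] at h1
  exact h1

/-- The Burkholder inequality for the maximal function, `p ≥ 2`. -/
theorem exists_integral_runMax_rpow_le_sqSum (hp : 2 ≤ p) :
    ∃ C : ℝ, 0 < C ∧ ∀ (P : Measure ℝ) [IsFiniteMeasure P] (j : ℤ) (f : ℕ → ℝ → ℝ),
      IsLevelMartingale (unitRestrict P j) f → f 0 = 0 → ∀ N,
      ∫ x, runMax f N x ^ p ∂(unitRestrict P j) ≤
        C * ∫ x, sqSum f N x ^ (p / 2) ∂(unitRestrict P j) := by
  obtain ⟨D, hD, hdoob⟩ := doob (p := p) (by linarith)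
  have hp1 : 0 < p - 1 := by linarith
  set c := D * (p * (p - 1)) with hc
  have hc0 : 0 < c := by positivity
  refine ⟨2 * (c * (2 * c) ^ (p / 2 - 1)), by positivity, fun P _ j f hf h0 N => ?_⟩
  have h1 := hdoob P j f hf N
  have h2 := mul_le_mul_of_nonneg_left (integral_abs_rpow_le hp hf h0 N) hD.le
  rw [← mul_assoc, ← hc] at h2
  have e1 : ∀ x, (runMax f N x ^ 2) ^ (p / 2) = runMax f N x ^ p := fun x =>
    sq_rpow_half (runMax_nonneg f N x) p
  have e2 : ∀ x, (runMax f N x ^ 2) ^ (p / 2 - 1) = runMax f N x ^ (p - 2) := fun x => by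
    rw [← sq_rpow_half (runMax_nonneg f N x) (p - 2)]
    congr 1
    ring
  -- Absorption with `Y` the square of the running maximum and `X` the sum of squares, so that `Y ^
  -- (p / 2 - 1)` is the factor `runMax ^ (p - 2)` of the Taylor bound.
  have := integral_rpow_le_of_le_mul (P := P) (j := j) (r := p / 2) (c := c) (by linarith) hc0.le
    (sqSum_level hf.level N) ((runMax_level hf.level N).comp fun t => t ^ 2) (sqSum_nonneg f N)
    (fun _ => sq_nonneg _)
  simp only [e1, e2] at this
  exact this (h1.trans h2)

theorem add_rpow_le_two_rpow_mul {s t : ℝ} (hs : 0 ≤ s) (ht : 0 ≤ t) (hr : 0 ≤ r) :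
    (s + t) ^ r ≤ 2 ^ r * (s ^ r + t ^ r) := by
  have h1 : 0 ≤ s ^ r := Real.rpow_nonneg hs r
  have h2 : 0 ≤ t ^ r := Real.rpow_nonneg ht r
  have h3 : (0 : ℝ) ≤ 2 ^ r := by positivity
  rcases le_total s t with h | h
  · calc (s + t) ^ r ≤ (2 * t) ^ r := by gcongr; linarith
      _ = 2 ^ r * t ^ r := Real.mul_rpow (by norm_num) ht
      _ ≤ _ := by gcongr; linarith
  · calc (s + t) ^ r ≤ (2 * s) ^ r := by gcongr; linarith
      _ = 2 ^ r * s ^ r := Real.mul_rpow (by norm_num) hs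
      _ ≤ _ := by gcongr; linarith

/-- The sum of squares up to `n + 1` is not of level `n`, but the new increment is at most `2 * W n`
in absolute value, so `sqSum f n + 4 * W n ^ 2` is a predictable majorant. With it as weight,
squares become increments of `f ^ 2`, only the last value of `f ^ 2` remains, and Young's inequality
closes the estimate. -/
theorem exists_integral_sqSum_rpow_le_of_abs_le (hp : 2 ≤ p) :
    ∃ C : ℝ, 0 < C ∧ ∀ (P : Measure ℝ) [IsFiniteMeasure P] (j : ℤ) (f W : ℕ → ℝ → ℝ),
      IsLevelMartingale (unitRestrict P j) f → f 0 = 0 → IsWeight W →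
      (∀ᵐ x ∂(unitRestrict P j), ∀ n, f (n + 1) x ^ 2 ≤ W n x ^ 2) → ∀ N,
      ∫ x, sqSum f (N + 1) x ^ (p / 2) ∂(unitRestrict P j) ≤
        C * ∫ x, W N x ^ p ∂(unitRestrict P j) := by
  have hr : 1 ≤ p / 2 := by linarith
  set r := p / 2 with hrp
  have hr0 : 0 < r := by linarith
  -- Splitting `B N ^ r` will cost a factor `2 ^ r`. Young's inequality is therefore applied to `2 ^
  -- r` times the quantity to be bounded, which leaves the coefficient `1 / 2` after division.
  set c : ℝ := 2 ^ r * r with hc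
  have hc0 : 0 < c := by positivity
  set D : ℝ := c * (2 * c) ^ (r - 1) / 2 ^ r with hD
  refine ⟨4 ^ r + 2 * D, by positivity, fun P _ j f W hf h0 hW h N => ?_⟩
  set B : ℕ → ℝ → ℝ := fun n x => sqSum f n x + 4 * W n x ^ 2 with hB
  have LB : ∀ n, LevelConst n (B n) := fun n =>
    (sqSum_level hf.level n).add ((hW.level n).comp fun t => 4 * t ^ 2)
  have B0 : ∀ n x, 0 ≤ B n x := fun n x => by
    have := sqSum_nonneg f n x
    positivity
  have Bm : ∀ x, Monotone fun n => B n x := fun x => monotone_nat_of_le_succ fun n => by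
    have h1 := sqSum_le_succ f n x
    have h2 : W n x ^ 2 ≤ W (n + 1) x ^ 2 :=
      pow_le_pow_left₀ (hW.pos n x).le (hW.mono x n.le_succ) 2
    simp only [hB]
    linarith
  have IQ := ((sqSum_level hf.level (N + 1)).rpow r).integrable (P := P) (j := j)
  have IW := ((hW.level N).rpow p).integrable (P := P) (j := j)
  have step1 : ∫ x, sqSum f (N + 1) x ^ r ∂(unitRestrict P j) ≤
      r * ∫ x, weightedSqSum f B (r - 1) N x ∂(unitRestrict P j) := by
    rw [← integral_const_mul]
    refine integral_mono_ae IQ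
      ((weightedSqSum_level hf.level LB _ N).integrable.const_mul r) ?_
    filter_upwards [h] with x hx
    refine (sum_rpow_le_telescope (fun i => sq_nonneg (f (i + 1) x - f i x)) hr (N + 1)).trans ?_
    refine mul_le_mul_of_nonneg_left (Finset.sum_le_sum fun i _ => ?_) hr0.le
    refine mul_le_mul_of_nonneg_right (Real.rpow_le_rpow (sqSum_nonneg f (i + 1) x) ?_
      (by linarith)) (sq_nonneg _)
    change sqSum f (i + 1) x ≤ B i x
    have hfi : f i x ^ 2 ≤ W i x ^ 2 := by
      cases i with
      | zero => rw [h0, Pi.zero_apply, zero_pow two_ne_zero]; positivity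
      | succ i =>
        exact (hx i).trans (pow_le_pow_left₀ (hW.pos i x).le (hW.mono x i.le_succ) 2)
    rw [sqSum_succ]
    simp only [hB]
    nlinarith [hx i, sq_nonneg (f (i + 1) x + f i x)]
  have step2 := integral_weightedSqSum_le_last hf h0 LB B0 Bm (s := r - 1) (by linarith) N
  have step3 : r * ∫ x, f (N + 1) x ^ 2 * B N x ^ (r - 1) ∂(unitRestrict P j) ≤
      ∫ x, (sqSum f (N + 1) x ^ r / 2 + (4 ^ r / 2 + D) * W N x ^ p) ∂(unitRestrict P j) := by
    rw [← integral_const_mul]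
    refine integral_mono_ae (Integrable.const_mul (LevelConst.integrable (n := N + 1)
      (((hf.level (N + 1)).comp fun t => t ^ 2).mul (((LB N).rpow _).mono N.le_succ))) r)
      ((IQ.div_const 2).add (IW.const_mul _)) ?_
    filter_upwards [h] with x hx
    have e : (W N x ^ 2) ^ r = W N x ^ p := sq_rpow_half (hW.pos N x).le p
    have y1 := mul_rpow_sub_one_le hc0.le (sq_nonneg (W N x)) (B0 N x) hr
    have y2 := add_rpow_le_two_rpow_mul (sqSum_nonneg f N x)
      (by positivity : 0 ≤ 4 * W N x ^ 2) hr0.le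
    rw [Real.mul_rpow (by norm_num) (sq_nonneg _), e] at y2
    rw [e] at y1
    have y3 : sqSum f N x ^ r ≤ sqSum f (N + 1) x ^ r :=
      Real.rpow_le_rpow (sqSum_nonneg f N x) (sqSum_le_succ f N x) hr0.le
    have y4 : f (N + 1) x ^ 2 * B N x ^ (r - 1) ≤ W N x ^ 2 * B N x ^ (r - 1) :=
      mul_le_mul_of_nonneg_right (hx N) (Real.rpow_nonneg (B0 N x) _)
    have h2r : (0 : ℝ) < 2 ^ r := by positivity
    have y5 : 2 ^ r * (r * (W N x ^ 2 * B N x ^ (r - 1))) ≤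
        2 ^ r * (sqSum f (N + 1) x ^ r / 2 + (4 ^ r / 2 + D) * W N x ^ p) := by
      have e2 : 2 ^ r * D = c * (2 * c) ^ (r - 1) := by rw [hD]; field_simp
      have y6 : B N x ^ r ≤ 2 ^ r * (sqSum f (N + 1) x ^ r + 4 ^ r * W N x ^ p) :=
        y2.trans (mul_le_mul_of_nonneg_left (by linarith) h2r.le)
      calc 2 ^ r * (r * (W N x ^ 2 * B N x ^ (r - 1)))
          = c * (W N x ^ 2 * B N x ^ (r - 1)) := by rw [hc]; ring
        _ ≤ B N x ^ r / 2 + c * (2 * c) ^ (r - 1) * W N x ^ p := y1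
        _ ≤ 2 ^ r * (sqSum f (N + 1) x ^ r + 4 ^ r * W N x ^ p) / 2 +
            2 ^ r * D * W N x ^ p := by rw [e2]; linarith
        _ = _ := by ring
    exact (mul_le_mul_of_nonneg_left y4 hr0.le).trans (le_of_mul_le_mul_left y5 h2r)
  rw [integral_add (IQ.div_const 2) (IW.const_mul _), integral_div, integral_const_mul] at step3
  have := mul_le_mul_of_nonneg_left step2 hr0.le
  linarith

end

/-! ### Bounds in terms of controls -/

section

variable {f a V W : ℕ → ℝ → ℝ} {P : Measure ℝ} [IsFiniteMeasure P] {j : ℤ} {p r : ℝ}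

/-- Non-negative adapted non-decreasing sequences of real functions. -/
structure IsLevelControl (V : ℕ → ℝ → ℝ) : Prop where
  level : ∀ n, LevelConst n (V n)
  nonneg : ∀ n x, 0 ≤ V n x
  mono : ∀ x, Monotone fun n => V n x

theorem IsLevelControl.isWeight_add (hV : IsLevelControl V) {ε : ℝ} (hε : 0 < ε) :
    IsWeight fun n x => V n x + ε where
  level n := (hV.level n).comp fun t => t + ε
  pos n x := by linarith [hV.nonneg n x]
  mono x _ _ h := by simpa using hV.mono x h

theorem IsLevelControl.sq_le_add_sq (hV : IsLevelControl V) {ε : ℝ} (hε : 0 < ε) (n : ℕ) (x : ℝ) :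
    V n x ^ 2 ≤ (V n x + ε) ^ 2 :=
  pow_le_pow_left₀ (hV.nonneg n x) (by linarith) 2

/-- Weights with a negative exponent must be positive, so controls are shifted by `ε`. As `ε` tends
to `0` the extra term vanishes because the measure is finite; the price is the factor `2 ^ p`. -/
theorem le_integral_rpow_of_forall_add {g : ℝ → ℝ} {n : ℕ} {X C : ℝ} (hp : 0 < p) (hC : 0 < C)
    (hg : LevelConst n g) (hg0 : ∀ x, 0 ≤ g x)
    (h : ∀ ε : ℝ, 0 < ε → X ≤ C * ∫ x, (g x + ε) ^ p ∂(unitRestrict P j)) :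
    X ≤ C * 2 ^ p * ∫ x, g x ^ p ∂(unitRestrict P j) := by
  set m := (unitRestrict P j).real univ
  have hlim : Filter.Tendsto
      (fun ε : ℝ => C * (2 ^ p * (∫ x, g x ^ p ∂(unitRestrict P j) + m * ε ^ p)))
      (nhdsWithin 0 (Ioi 0))
      (nhds (C * (2 ^ p * (∫ x, g x ^ p ∂(unitRestrict P j) + m * (0 : ℝ) ^ p)))) := by
    have : Continuous fun ε : ℝ => ε ^ p := Real.continuous_rpow_const hp.le
    exact Filter.Tendsto.mono_left (Continuous.tendsto (by fun_prop) 0) nhdsWithin_le_nhds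
  rw [Real.zero_rpow hp.ne', mul_zero, add_zero, ← mul_assoc] at hlim
  refine ge_of_tendsto hlim (Filter.eventually_of_mem self_mem_nhdsWithin fun ε hε => ?_)
  have hε : 0 < ε := hε
  refine (h ε hε).trans (mul_le_mul_of_nonneg_left ?_ hC.le)
  have I1 := (hg.rpow p).integrable (P := P) (j := j)
  have e : ∫ _, ε ^ p ∂(unitRestrict P j) = m * ε ^ p := by
    rw [integral_const, smul_eq_mul]
  rw [← e, ← integral_add I1 (integrable_const _), ← integral_const_mul]
  refine integral_mono ((hg.comp fun t => (t + ε) ^ p).integrable)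
    ((I1.add (integrable_const _)).const_mul _) fun x => ?_
  exact add_rpow_le_two_rpow_mul (hg0 x) hε.le hp.le

theorem integral_rpow_nonneg {g : ℝ → ℝ} (hg0 : ∀ x, 0 ≤ g x) (p : ℝ) (μ : Measure ℝ) :
    0 ≤ ∫ x, g x ^ p ∂μ :=
  integral_nonneg fun x => Real.rpow_nonneg (hg0 x) p

/-- The three operators are controlled by `V` as soon as the weighted sums of squares are. -/
theorem exists_bounds_of_weightedSqSum_le (hp : 0 < p) (hp2 : p ≤ 2) {c : ℝ} (hc : 0 < c) :
    ∃ C : ℝ, 0 < C ∧ ∀ (P : Measure ℝ) [IsFiniteMeasure P] (j : ℤ) (f a V : ℕ → ℝ → ℝ),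
      IsLevelMartingale (unitRestrict P j) f → f 0 = 0 → IsCondSquare (unitRestrict P j) f a →
      IsLevelControl V → ∀ N,
      (∀ ε : ℝ, 0 < ε →
        ∫ x, weightedSqSum f (fun n x => V n x + ε) (p - 2) N x ∂(unitRestrict P j) ≤
          c * ∫ x, (V N x + ε) ^ p ∂(unitRestrict P j)) →
      ∫ x, runMax f (N + 1) x ^ p ∂(unitRestrict P j) ≤
          C * ∫ x, V N x ^ p ∂(unitRestrict P j) ∧
        ∫ x, sqSum f (N + 1) x ^ (p / 2) ∂(unitRestrict P j) ≤
          C * ∫ x, V N x ^ p ∂(unitRestrict P j) ∧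
        ∫ x, (∑ i ∈ Finset.range (N + 1), a i x) ^ (p / 2) ∂(unitRestrict P j) ≤
          C * ∫ x, V N x ^ p ∂(unitRestrict P j) := by
  obtain ⟨D, hD, hmax⟩ := exists_integral_runMax_rpow_le_weighted hp hp2
  -- The weighted sum enters with factor `D` for the maximal function and `1` for the two square
  -- functions; the last `1` accounts for the integral of `W N ^ p`.
  set C := max D 1 * c + 1
  have hD1 : 1 ≤ max D 1 := le_max_right _ _
  have hC : 0 < C := by positivity
  refine ⟨C * 2 ^ p, by positivity, fun P _ j f a V hf h0 ha hV N h => ?_⟩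
  have key : ∀ ε : ℝ, 0 < ε → ∀ X : ℝ,
      X ≤ max D 1 * ∫ x, weightedSqSum f (fun n x => V n x + ε) (p - 2) N x ∂(unitRestrict P j) +
        ∫ x, (V N x + ε) ^ p ∂(unitRestrict P j) →
      X ≤ C * ∫ x, (V N x + ε) ^ p ∂(unitRestrict P j) := by
    intro ε hε X hX
    have := mul_le_mul_of_nonneg_left (h ε hε) (zero_le_one.trans hD1)
    simp only [C]
    linarith
  have wnn : ∀ ε : ℝ, 0 < ε →
      0 ≤ ∫ x, weightedSqSum f (fun n x => V n x + ε) (p - 2) N x ∂(unitRestrict P j) := by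
    intro ε hε
    refine integral_nonneg fun x => Finset.sum_nonneg fun i _ => ?_
    exact mul_nonneg (Real.rpow_nonneg ((hV.isWeight_add hε).pos i x).le _) (sq_nonneg _)
  refine ⟨?_, ?_, ?_⟩ <;>
    refine le_integral_rpow_of_forall_add hp hC (hV.level N) (hV.nonneg N) fun ε hε =>
      key ε hε _ ?_
  · refine (hmax P j f _ hf h0 (hV.isWeight_add hε) N).trans ?_
    have := mul_le_mul_of_nonneg_right (le_max_left D 1) (wnn ε hε)
    linarith
  · refine (integral_sqSum_rpow_le_weighted hp hp2 hf.level (hV.isWeight_add hε) N).trans ?_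
    have := mul_le_mul_of_nonneg_right hD1 (wnn ε hε)
    linarith
  · refine (integral_condSum_rpow_le_weighted hp hp2 hf.level ha (hV.isWeight_add hε) N).trans ?_
    have := mul_le_mul_of_nonneg_right hD1 (wnn ε hε)
    linarith

theorem IsCondSquare.isLevelControl {μ : Measure ℝ} (ha : IsCondSquare μ f a) :
    IsLevelControl fun n x => √(∑ i ∈ Finset.range (n + 1), a i x) where
  level n := (LevelConst.sum fun i hi =>
    (ha.level i).mono (Nat.lt_succ_iff.1 (Finset.mem_range.1 hi))).comp Real.sqrt
  nonneg n x := Real.sqrt_nonneg _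
  mono x := monotone_nat_of_le_succ fun n => by
    refine Real.sqrt_le_sqrt ?_
    rw [Finset.sum_range_succ _ (n + 1)]
    linarith [ha.nonneg (n + 1) x]

theorem sqrt_rpow {t : ℝ} (ht : 0 ≤ t) (p : ℝ) : √t ^ p = t ^ (p / 2) := by
  rw [← sq_rpow_half (Real.sqrt_nonneg t) p, Real.sq_sqrt ht]

/-- The conditional square function is predictable and thus serves as its own control. -/
theorem exists_bounds_condSum (hp : 0 < p) (hp2 : p ≤ 2) :
    ∃ C : ℝ, 0 < C ∧ ∀ (P : Measure ℝ) [IsFiniteMeasure P] (j : ℤ) (f a : ℕ → ℝ → ℝ),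
      IsLevelMartingale (unitRestrict P j) f → f 0 = 0 → IsCondSquare (unitRestrict P j) f a →
      ∀ N, ∫ x, runMax f (N + 1) x ^ p ∂(unitRestrict P j) ≤
          C * ∫ x, (∑ i ∈ Finset.range (N + 1), a i x) ^ (p / 2) ∂(unitRestrict P j) ∧
        ∫ x, sqSum f (N + 1) x ^ (p / 2) ∂(unitRestrict P j) ≤
          C * ∫ x, (∑ i ∈ Finset.range (N + 1), a i x) ^ (p / 2) ∂(unitRestrict P j) := by
  obtain ⟨C, hC, h⟩ := exists_bounds_of_weightedSqSum_le hp hp2 (c := 2 / p) (by positivity)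
  refine ⟨C, hC, fun P _ j f a hf h0 ha N => ?_⟩
  have h0a : ∀ n x, 0 ≤ ∑ i ∈ Finset.range (n + 1), a i x := fun n x =>
    Finset.sum_nonneg fun i _ => ha.nonneg i x
  have := h P j f a _ hf h0 ha ha.isLevelControl N fun ε hε =>
    integral_weightedSqSum_le_of_condSum_le hp hp2 hf.level ha (ha.isLevelControl.isWeight_add hε)
      (fun n x => by
        have := ha.isLevelControl.sq_le_add_sq hε n x
        rwa [Real.sq_sqrt (h0a n x)] at this) N
  simp only [sqrt_rpow (h0a N _)] at this
  exact ⟨this.1, this.2.1⟩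

theorem exists_condSum_bounds (hp2 : 2 ≤ p) :
    ∃ C : ℝ, 0 < C ∧ ∀ (P : Measure ℝ) [IsFiniteMeasure P] (j : ℤ) (f a : ℕ → ℝ → ℝ),
      IsLevelMartingale (unitRestrict P j) f → f 0 = 0 → IsCondSquare (unitRestrict P j) f a →
      ∀ N, ∫ x, (∑ i ∈ Finset.range (N + 1), a i x) ^ (p / 2) ∂(unitRestrict P j) ≤
          C * ∫ x, runMax f (N + 1) x ^ p ∂(unitRestrict P j) ∧
        ∫ x, (∑ i ∈ Finset.range (N + 1), a i x) ^ (p / 2) ∂(unitRestrict P j) ≤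
          C * ∫ x, sqSum f (N + 1) x ^ (p / 2) ∂(unitRestrict P j) := by
  have hr : 1 ≤ p / 2 := by linarith
  have hC : 0 < 2 * (p / 2 * (2 * (p / 2)) ^ (p / 2 - 1)) := by positivity
  refine ⟨_, hC, fun P _ j f a hf h0 ha N =>
    ⟨(integral_condSum_rpow_le_sq hf ha h0 hr N).trans (mul_le_mul_of_nonneg_left ?_ hC.le),
      integral_condSum_rpow_le_sqSum hf ha hr N⟩⟩
  refine integral_mono ((hf.level (N + 1)).comp fun t => (t ^ 2) ^ (p / 2)).integrable
    ((runMax_level hf.level _).rpow p).integrable fun x => ?_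
  simp only
  rw [← sq_abs, sq_rpow_half (abs_nonneg _)]
  exact Real.rpow_le_rpow (abs_nonneg _) (abs_le_runMax f le_rfl x) (by linarith)

theorem exists_bounds_of_abs_le (hp : 0 < p) :
    ∃ C : ℝ, 0 < C ∧ ∀ (P : Measure ℝ) [IsFiniteMeasure P] (j : ℤ) (f a V : ℕ → ℝ → ℝ),
      IsLevelMartingale (unitRestrict P j) f → f 0 = 0 → IsCondSquare (unitRestrict P j) f a →
      IsLevelControl V → (∀ᵐ x ∂(unitRestrict P j), ∀ n, f (n + 1) x ^ 2 ≤ V n x ^ 2) → ∀ N,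
      ∫ x, sqSum f (N + 1) x ^ (p / 2) ∂(unitRestrict P j) ≤
          C * ∫ x, V N x ^ p ∂(unitRestrict P j) ∧
        ∫ x, (∑ i ∈ Finset.range (N + 1), a i x) ^ (p / 2) ∂(unitRestrict P j) ≤
          C * ∫ x, V N x ^ p ∂(unitRestrict P j) := by
  rcases le_total p 2 with hp2 | hp2
  · obtain ⟨C, hC, h⟩ := exists_bounds_of_weightedSqSum_le hp hp2 (c := 1 + 2 / p) (by positivity)
    refine ⟨C, hC, fun P _ j f a V hf h0 ha hV hVf N => ?_⟩
    refine (h P j f a V hf h0 ha hV N fun ε hε => ?_).2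
    refine integral_weightedSqSum_le_of_abs_le hp hp2 hf h0 (hV.isWeight_add hε) ?_ N
    filter_upwards [hVf] with x hx n using (hx n).trans (hV.sq_le_add_sq hε n x)
  · have hr : 1 ≤ p / 2 := by linarith
    obtain ⟨C, hC, h⟩ := exists_integral_sqSum_rpow_le_of_abs_le hp2
    set D := 2 * (p / 2 * (2 * (p / 2)) ^ (p / 2 - 1))
    have hD : 0 < D := by positivity
    refine ⟨C * 2 ^ p + D, by positivity, fun P _ j f a V hf h0 ha hV hVf N => ?_⟩
    have h1 : ∫ x, sqSum f (N + 1) x ^ (p / 2) ∂(unitRestrict P j) ≤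
        C * 2 ^ p * ∫ x, V N x ^ p ∂(unitRestrict P j) := by
      refine le_integral_rpow_of_forall_add hp hC (hV.level N) (hV.nonneg N) fun ε hε => ?_
      refine h P j f _ hf h0 (hV.isWeight_add hε) ?_ N
      filter_upwards [hVf] with x hx n using (hx n).trans (hV.sq_le_add_sq hε n x)
    have h2 : ∫ x, (∑ i ∈ Finset.range (N + 1), a i x) ^ (p / 2) ∂(unitRestrict P j) ≤
        D * ∫ x, V N x ^ p ∂(unitRestrict P j) := by
      refine (integral_condSum_rpow_le_sq hf ha h0 hr N).trans
        (mul_le_mul_of_nonneg_left ?_ hD.le)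
      refine integral_mono_ae ((hf.level (N + 1)).comp fun t => (t ^ 2) ^ (p / 2)).integrable
        ((hV.level N).rpow p).integrable ?_
      filter_upwards [hVf] with x hx
      rw [← sq_rpow_half (hV.nonneg N x)]
      exact Real.rpow_le_rpow (sq_nonneg _) (hx N) (by linarith)
    have h3 := integral_rpow_nonneg (hV.nonneg N) p (unitRestrict P j)
    have h4 : 0 ≤ C * 2 ^ p := by positivity
    constructor <;> nlinarith

theorem exists_bounds_of_sqSum_le (hp : 0 < p) :
    ∃ C : ℝ, 0 < C ∧ ∀ (P : Measure ℝ) [IsFiniteMeasure P] (j : ℤ) (f a V : ℕ → ℝ → ℝ),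
      IsLevelMartingale (unitRestrict P j) f → f 0 = 0 → IsCondSquare (unitRestrict P j) f a →
      IsLevelControl V → (∀ᵐ x ∂(unitRestrict P j), ∀ n, sqSum f (n + 1) x ≤ V n x ^ 2) → ∀ N,
      ∫ x, runMax f (N + 1) x ^ p ∂(unitRestrict P j) ≤
          C * ∫ x, V N x ^ p ∂(unitRestrict P j) ∧
        ∫ x, (∑ i ∈ Finset.range (N + 1), a i x) ^ (p / 2) ∂(unitRestrict P j) ≤
          C * ∫ x, V N x ^ p ∂(unitRestrict P j) := by
  rcases le_total p 2 with hp2 | hp2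
  · obtain ⟨C, hC, h⟩ := exists_bounds_of_weightedSqSum_le hp hp2 (c := 2 / p) (by positivity)
    refine ⟨C, hC, fun P _ j f a V hf h0 ha hV hVf N => ?_⟩
    have := h P j f a V hf h0 ha hV N fun ε hε => ?_
    · exact ⟨this.1, this.2.2⟩
    refine integral_weightedSqSum_le_of_sqSum_le hp hp2 hf.level (hV.isWeight_add hε) ?_ N
    filter_upwards [hVf] with x hx n using (hx n).trans (hV.sq_le_add_sq hε n x)
  · obtain ⟨C, hC, h⟩ := exists_integral_runMax_rpow_le_sqSum hp2
    obtain ⟨D, hD, h'⟩ := exists_condSum_bounds hp2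
    refine ⟨C + D, by positivity, fun P _ j f a V hf h0 ha hV hVf N => ?_⟩
    have h1 : ∫ x, sqSum f (N + 1) x ^ (p / 2) ∂(unitRestrict P j) ≤
        ∫ x, V N x ^ p ∂(unitRestrict P j) := by
      refine integral_mono_ae ((sqSum_level hf.level (N + 1)).rpow _).integrable
        ((hV.level N).rpow p).integrable ?_
      filter_upwards [hVf] with x hx
      rw [← sq_rpow_half (hV.nonneg N x)]
      exact Real.rpow_le_rpow (sqSum_nonneg _ _ _) (hx N) (by linarith)
    have h2 := h P j f hf h0 (N + 1)
    have h3 := (h' P j f a hf h0 ha N).2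
    have h4 := integral_rpow_nonneg (hV.nonneg N) p (unitRestrict P j)
    constructor <;> nlinarith

end

/-! ### Passage to the limit -/

section

variable {f : ℕ → ℝ → ℝ} {P : Measure ℝ} [IsProbabilityMeasure P] {j : ℤ} {p : ℝ}

/-- The sequence `f` with its initial value subtracted. -/
noncomputable def centered (f : ℕ → ℝ → ℝ) (n : ℕ) (x : ℝ) : ℝ := f n x - f 0 x

/-- The real-valued conditional square of the increment `f (n + 1) - f n`. -/
noncomputable def condSq (P : Measure ℝ) (f : ℕ → ℝ → ℝ) (n : ℕ) (x : ℝ) : ℝ :=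
  (condLExp (dyadicFiltration n) P (fun y => ‖f (n + 1) y - f n y‖ₑ ^ 2) x).toReal

theorem centered_diff (f : ℕ → ℝ → ℝ) (n : ℕ) (x : ℝ) :
    centered f (n + 1) x - centered f n x = f (n + 1) x - f n x := by
  simp [centered]

theorem sqSum_centered (f : ℕ → ℝ → ℝ) (n : ℕ) (x : ℝ) :
    sqSum (centered f) n x = sqSum f n x := by
  simp only [sqSum, centered_diff]

/-- The initial value of a martingale in the class vanishes only almost surely. Subtracting it makes
it vanish everywhere, as the pathwise sums require, and leaves the increments unchanged. -/
theorem centered_zero (f : ℕ → ℝ → ℝ) : centered f 0 = 0 := by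
  ext x
  simp [centered]

theorem levelConst_of_martingale {μ : Measure ℝ} (hf : Martingale f dyadicFiltration μ) (n : ℕ) :
    LevelConst n (f n) :=
  LevelConst.of_measurable (hf.stronglyMeasurable n).measurable

theorem centered_level (hf : ∀ n, LevelConst n (f n)) (n : ℕ) : LevelConst n (centered f n) :=
  (hf n).comp₂ ((hf 0).mono n.zero_le) fun s t => s - t

theorem centered_isLevelMartingale (hf : Martingale f dyadicFiltration P) :
    IsLevelMartingale (unitRestrict P j) (centered f) where
  level := centered_level (levelConst_of_martingale hf)
  orth n ξ hξ := by
    have L := levelConst_of_martingale hf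
    simp only [centered_diff]
    rw [integral_mul_congr_of_atoms (diff_level L le_rfl) (LevelConst.const (n + 1) (0 : ℝ)) hξ]
    · simp
    · intro k _
      rw [integral_sub (hf.integrable _).integrableOn (hf.integrable _).integrableOn,
        ← hf.setIntegral_eq n.le_succ (measurableSet_dyadicInterval n k)]
      simp

theorem levelConst_sq_enorm (hf : ∀ n, LevelConst n (f n)) (n : ℕ) :
    LevelConst (n + 1) (fun y => ‖f (n + 1) y - f n y‖ₑ ^ 2) :=
  (diff_level hf le_rfl).comp fun t => ‖t‖ₑ ^ 2

theorem sq_enorm_eq (t : ℝ) : ‖t‖ₑ ^ 2 = ENNReal.ofReal (t ^ 2) := by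
  rw [Real.enorm_eq_ofReal_abs, ← ENNReal.ofReal_pow (abs_nonneg t), sq_abs]

theorem lintegral_sq_enorm_lt_top (hf : ∀ n, LevelConst n (f n)) (n : ℕ) :
    ∫⁻ y, ‖f (n + 1) y - f n y‖ₑ ^ 2 ∂(unitRestrict P j) < ∞ := by
  simp only [sq_enorm_eq]
  exact ((diff_level hf le_rfl).comp fun t => t ^ 2).integrable.lintegral_lt_top

theorem measurableSet_unit (n : ℕ) (j : ℤ) :
    MeasurableSet[dyadicFiltration n] (Ico (j : ℝ) (j + 1)) := by
  have := dyadicFiltration.mono n.zero_le _ (measurableSet_dyadicInterval 0 j)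
  simpa [dyadicInterval] using this

/-- The squared increment need not be integrable on the line, but it is on each unit interval, and
these intervals belong to every level, so its conditional expectation can be integrated over them.
-/
theorem condLExp_lt_top_ae (hf : ∀ n, LevelConst n (f n)) (n : ℕ) :
    ∀ᵐ x ∂(unitRestrict P j),
      condLExp (dyadicFiltration n) P (fun y => ‖f (n + 1) y - f n y‖ₑ ^ 2) x < ∞ := by
  refine ae_lt_top (measurable_condLExp' _ _ _) ?_
  rw [setLIntegral_condLExp (dyadicFiltration.le n) P _ (measurableSet_unit n j)]
  exact (lintegral_sq_enorm_lt_top hf n).ne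

theorem condSq_level (P : Measure ℝ) (f : ℕ → ℝ → ℝ) (n : ℕ) : LevelConst n (condSq P f n) :=
  (LevelConst.of_measurable (measurable_condLExp _ _ _)).comp ENNReal.toReal

theorem setIntegral_condSq (hf : ∀ n, LevelConst n (f n)) {n : ℕ} {k : ℤ}
    (hk : k ∈ Finset.Ico (j * 2 ^ n) ((j + 1) * 2 ^ n)) :
    ∫ x in dyadicInterval n k, (f (n + 1) x - f n x) ^ 2 ∂P =
      ∫ x in dyadicInterval n k, condSq P f n x ∂P := by
  have hsub := Measure.restrict_mono_set P (dyadicInterval_subset_unit hk)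
  simp only [condSq]
  rw [integral_toReal (measurable_condLExp' _ _ _).aemeasurable
    (ae_mono hsub (condLExp_lt_top_ae hf n)),
    setLIntegral_condLExp (dyadicFiltration.le n) P _ (measurableSet_dyadicInterval n k),
    ← integral_toReal (levelConst_sq_enorm hf n).measurable.aemeasurable]
  · simp
  · exact ae_mono hsub (ae_lt_top (levelConst_sq_enorm hf n).measurable
      (lintegral_sq_enorm_lt_top hf n).ne)

theorem condSq_isCondSquare (hf : ∀ n, LevelConst n (f n)) :
    IsCondSquare (unitRestrict P j) (centered f) (condSq P f) where
  level := condSq_level P f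
  nonneg _ _ := ENNReal.toReal_nonneg
  orth n ξ hξ := by
    simp only [centered_diff]
    exact integral_mul_congr_of_atoms ((diff_level hf le_rfl).comp fun t => t ^ 2)
      ((condSq_level P f n).mono n.le_succ) hξ fun k hk => setIntegral_condSq hf hk

theorem iSup_rpow {ι : Type*} (u : ι → ℝ≥0∞) (hp : 0 < p) : (⨆ i, u i) ^ p = ⨆ i, u i ^ p :=
  (ENNReal.orderIsoRpow p hp).map_iSup u

theorem iSup_ofReal_rpow {u : ℕ → ℝ} (hu : ∀ n, 0 ≤ u n) (hp : 0 < p) :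
    (⨆ n, ENNReal.ofReal (u n)) ^ p = ⨆ n, ENNReal.ofReal (u n ^ p) := by
  rw [iSup_rpow _ hp]
  exact iSup_congr fun n => ENNReal.ofReal_rpow_of_nonneg (hu n) hp.le

theorem tsum_ofReal_rpow {b : ℕ → ℝ} (hb : ∀ n, 0 ≤ b n) (hp : 0 < p) :
    ((∑' i, ENNReal.ofReal (b i)) ^ (1 / 2 : ℝ)) ^ p =
      ⨆ N, ENNReal.ofReal ((∑ i ∈ Finset.range (N + 1), b i) ^ (p / 2)) := by
  have h0 : ∀ n, 0 ≤ ∑ i ∈ Finset.range n, b i := fun n => Finset.sum_nonneg fun i _ => hb i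
  have e : ∑' i, ENNReal.ofReal (b i) =
      ⨆ N, ENNReal.ofReal (∑ i ∈ Finset.range (N + 1), b i) := by
    rw [ENNReal.tsum_eq_iSup_nat' (Filter.tendsto_add_atTop_nat 1)]
    exact iSup_congr fun N => (ENNReal.ofReal_sum_of_nonneg fun i _ => hb i).symm
  rw [← ENNReal.rpow_mul, e, one_div_mul_eq_div, iSup_ofReal_rpow (fun N => h0 _) (by positivity)]

theorem exists_runMax_eq (f : ℕ → ℝ → ℝ) (n : ℕ) (x : ℝ) : ∃ k, runMax f n x = |f k x| := by
  induction n with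
  | zero => exact ⟨0, rfl⟩
  | succ n ih =>
    rcases max_choice (runMax f n x) |f (n + 1) x| with h | h
    · exact ih.imp fun k hk => h.trans hk
    · exact ⟨n + 1, h⟩

theorem maximalFunction_rpow {μ : Measure ℝ} (h0 : f 0 =ᵐ[μ] 0) (hp : 0 < p) :
    ∀ᵐ x ∂μ, maximalFunction f x ^ p =
      ⨆ N, ENNReal.ofReal (runMax (centered f) (N + 1) x ^ p) := by
  filter_upwards [h0] with x hx
  rw [← iSup_ofReal_rpow (fun N => runMax_nonneg _ _ _) hp]
  congr 1
  have e : ∀ n, ‖f n x‖ₑ = ENNReal.ofReal |centered f n x| := fun n => by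
    rw [centered, hx, Pi.zero_apply, sub_zero, Real.enorm_eq_ofReal_abs]
  simp only [maximalFunction, e]
  refine le_antisymm (iSup_le fun n => ?_) (iSup_le fun N => ?_)
  · exact le_iSup_of_le n (ENNReal.ofReal_le_ofReal (abs_le_runMax _ n.le_succ x))
  · obtain ⟨k, hk⟩ := exists_runMax_eq (centered f) (N + 1) x
    rw [hk]
    exact le_iSup (fun n => ENNReal.ofReal |centered f n x|) k

theorem squareFunction_rpow (f : ℕ → ℝ → ℝ) (hp : 0 < p) (x : ℝ) :
    squareFunction f x ^ p =
      ⨆ N, ENNReal.ofReal (sqSum (centered f) (N + 1) x ^ (p / 2)) := by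
  simp only [squareFunction, sq_enorm_eq, sqSum_centered]
  exact tsum_ofReal_rpow (fun _ => sq_nonneg _) hp

theorem condSquareFunction_rpow (hf : ∀ n, LevelConst n (f n)) (hp : 0 < p) :
    ∀ᵐ x ∂(unitRestrict P j), condSquareFunction P f x ^ p =
      ⨆ N, ENNReal.ofReal ((∑ i ∈ Finset.range (N + 1), condSq P f i x) ^ (p / 2)) := by
  filter_upwards [ae_all_iff.2 fun n => condLExp_lt_top_ae (P := P) (j := j) hf n] with x hx
  rw [← tsum_ofReal_rpow (b := fun i => condSq P f i x) (fun _ => ENNReal.toReal_nonneg) hp]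
  simp only [condSquareFunction, condSq, ENNReal.ofReal_toReal (hx _).ne]

theorem controlLimit_rpow (ϱ : ℕ → ℝ → ℝ≥0) (hp : 0 < p) (x : ℝ) :
    controlLimit ϱ x ^ p = ⨆ N, ENNReal.ofReal ((ϱ N x : ℝ) ^ p) := by
  rw [← iSup_ofReal_rpow (fun N => NNReal.coe_nonneg _) hp]
  simp only [controlLimit, ENNReal.ofReal_coe_nnreal]

theorem isLevelControl_of_isControl {ϱ : ℕ → ℝ → ℝ≥0} (h : IsControl ϱ) :
    IsLevelControl fun n x => (ϱ n x : ℝ) where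
  level n := (LevelConst.of_measurable (h.1 n)).comp NNReal.toReal
  nonneg _ _ := NNReal.coe_nonneg _
  mono x _ _ hmn := NNReal.coe_le_coe.2 (h.2 hmn x)

/-- Non-decreasing sequences of non-negative functions, the `n`-th one of level `n + 1`. -/
structure IsMonotoneLevel (G : ℕ → ℝ → ℝ) : Prop where
  level : ∀ n, LevelConst (n + 1) (G n)
  nonneg : ∀ n x, 0 ≤ G n x
  mono : ∀ x, Monotone fun n => G n x

theorem lintegral_iSup_ofReal {G : ℕ → ℝ → ℝ} (hG : IsMonotoneLevel G) :
    ∫⁻ x, ⨆ n, ENNReal.ofReal (G n x) ∂(unitRestrict P j) =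
      ⨆ n, ENNReal.ofReal (∫ x, G n x ∂(unitRestrict P j)) := by
  rw [lintegral_iSup (fun n => (hG.level n).measurable.ennreal_ofReal)
    (fun _ _ h x => ENNReal.ofReal_le_ofReal (hG.mono x h))]
  exact iSup_congr fun n => (ofReal_integral_eq_lintegral_ofReal (hG.level n).integrable
    (Filter.Eventually.of_forall (hG.nonneg n))).symm

theorem lintegral_iSup_ofReal_le {G H : ℕ → ℝ → ℝ} {C : ℝ} (hG : IsMonotoneLevel G)
    (hH : IsMonotoneLevel H) (hC : 0 ≤ C)
    (h : ∀ n, ∫ x, G n x ∂(unitRestrict P j) ≤ C * ∫ x, H n x ∂(unitRestrict P j)) :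
    ∫⁻ x, ⨆ n, ENNReal.ofReal (G n x) ∂(unitRestrict P j) ≤
      ENNReal.ofReal C * ∫⁻ x, ⨆ n, ENNReal.ofReal (H n x) ∂(unitRestrict P j) := by
  rw [lintegral_iSup_ofReal hG, lintegral_iSup_ofReal hH, ENNReal.mul_iSup]
  refine iSup_mono fun n => ?_
  rw [← ENNReal.ofReal_mul hC]
  exact ENNReal.ofReal_le_ofReal (h n)

/-- `g ^ p` is the increasing limit of the sequence `G`. -/
structure Represents (P : Measure ℝ) (p : ℝ) (g : ℝ → ℝ≥0∞) (G : ℕ → ℝ → ℝ) : Prop where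
  isMonotoneLevel : IsMonotoneLevel G
  rpow_eq : ∀ j : ℤ, ∀ᵐ x ∂(unitRestrict P j), g x ^ p = ⨆ n, ENNReal.ofReal (G n x)

theorem represents_maximalFunction {μ : Measure ℝ} (hf : IsDyadicMartingale μ f) (hp : 0 < p) :
    Represents μ p (maximalFunction f) fun N x => runMax (centered f) (N + 1) x ^ p where
  isMonotoneLevel :=
    { level := fun n =>
        (runMax_level (centered_level (levelConst_of_martingale hf.1)) (n + 1)).rpow p
      nonneg := fun _ _ => Real.rpow_nonneg (runMax_nonneg _ _ _) p
      mono := fun _ => monotone_nat_of_le_succ fun _ =>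
        Real.rpow_le_rpow (runMax_nonneg _ _ _) (le_max_left _ _) hp.le }
  rpow_eq _ := ae_restrict_of_ae (maximalFunction_rpow hf.2 hp)

theorem represents_squareFunction {μ : Measure ℝ} (hf : IsDyadicMartingale μ f) (hp : 0 < p) :
    Represents μ p (squareFunction f) fun N x => sqSum (centered f) (N + 1) x ^ (p / 2) where
  isMonotoneLevel :=
    { level := fun n =>
        (sqSum_level (centered_level (levelConst_of_martingale hf.1)) (n + 1)).rpow _
      nonneg := fun _ _ => Real.rpow_nonneg (sqSum_nonneg _ _ _) _
      mono := fun _ => monotone_nat_of_le_succ fun _ =>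
        Real.rpow_le_rpow (sqSum_nonneg _ _ _) (sqSum_le_succ _ _ _) (by positivity) }
  rpow_eq _ := Filter.Eventually.of_forall (squareFunction_rpow f hp)

theorem represents_condSquareFunction (hf : IsDyadicMartingale P f) (hp : 0 < p) :
    Represents P p (condSquareFunction P f)
      fun N x => (∑ i ∈ Finset.range (N + 1), condSq P f i x) ^ (p / 2) where
  isMonotoneLevel :=
    { level := fun n => (LevelConst.sum fun i hi => (condSq_level P f i).mono
        (Finset.mem_range.1 hi).le).rpow _
      nonneg := fun _ _ => Real.rpow_nonneg
        (Finset.sum_nonneg fun _ _ => ENNReal.toReal_nonneg) _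
      mono := fun x => monotone_nat_of_le_succ fun n =>
        Real.rpow_le_rpow (Finset.sum_nonneg fun _ _ => ENNReal.toReal_nonneg) (by
          rw [Finset.sum_range_succ _ (n + 1)]
          exact le_add_of_nonneg_right ENNReal.toReal_nonneg) (by positivity) }
  rpow_eq _ := condSquareFunction_rpow (levelConst_of_martingale hf.1) hp

theorem represents_controlLimit (P : Measure ℝ) {ϱ : ℕ → ℝ → ℝ≥0} (h : IsControl ϱ) (hp : 0 < p) :
    Represents P p (controlLimit ϱ) fun N x => (ϱ N x : ℝ) ^ p where
  isMonotoneLevel :=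
    { level := fun n => (((isLevelControl_of_isControl h).level n).rpow p).mono n.le_succ
      nonneg := fun _ _ => Real.rpow_nonneg (NNReal.coe_nonneg _) p
      mono := fun x _ _ hmn => Real.rpow_le_rpow (NNReal.coe_nonneg _)
        ((isLevelControl_of_isControl h).mono x hmn) hp.le }
  rpow_eq _ := Filter.Eventually.of_forall (controlLimit_rpow ϱ hp)

theorem Represents.lintegral_le {g h : ℝ → ℝ≥0∞} {G H : ℕ → ℝ → ℝ} {C : ℝ}
    (hg : Represents P p g G) (hh : Represents P p h H) (hC : 0 ≤ C)
    (hle : ∀ n, ∫ x, G n x ∂(unitRestrict P j) ≤ C * ∫ x, H n x ∂(unitRestrict P j)) :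
    ∫⁻ x, g x ^ p ∂(unitRestrict P j) ≤ ENNReal.ofReal C * ∫⁻ x, h x ^ p ∂(unitRestrict P j) := by
  rw [lintegral_congr_ae (hg.rpow_eq j), lintegral_congr_ae (hh.rpow_eq j)]
  exact lintegral_iSup_ofReal_le hg.isMonotoneLevel hh.isMonotoneLevel hC hle

end

/-! ### Embeddings for general measures -/

section

variable {p : ℝ≥0∞}

/-- The `ℓ_q` quantity is monotone and homogeneous, so a constant common to all `j` survives
unchanged. Hence no constant depends on `q`. -/
theorem amalgamNorm_le_of_eLpNorm_le {P : Measure ℝ} {q : ℝ≥0∞} (hq : 0 < q) {g h : ℝ → ℝ≥0∞}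
    {C : ℝ≥0∞}
    (H : ∀ j : ℤ, eLpNorm g p (unitRestrict P j) ≤ C * eLpNorm h p (unitRestrict P j)) :
    amalgamNorm P p q g ≤ C * amalgamNorm P p q h := by
  unfold amalgamNorm
  split_ifs with hq'
  · rw [ENNReal.mul_iSup]
    exact iSup_mono H
  · have hq0 : 0 < q.toReal := ENNReal.toReal_pos hq.ne' hq'
    calc (∑' j : ℤ, eLpNorm g p (unitRestrict P j) ^ q.toReal) ^ (1 / q.toReal)
        ≤ (∑' j : ℤ, (C * eLpNorm h p (unitRestrict P j)) ^ q.toReal) ^ (1 / q.toReal) := by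
          gcongr with j
          exact H j
      _ = _ := by
          simp only [ENNReal.mul_rpow_of_nonneg _ _ hq0.le]
          rw [ENNReal.tsum_mul_left, ENNReal.mul_rpow_of_nonneg _ _ (by positivity),
            ← ENNReal.rpow_mul, mul_one_div_cancel hq0.ne', ENNReal.rpow_one]

theorem amalgamNorm_le_of_lintegral_le {P : Measure ℝ} {q : ℝ≥0∞} (hp0 : 0 < p) (hp : p < ∞)
    (hq : 0 < q) {g h : ℝ → ℝ≥0∞} {C : ℝ} (hC : 0 ≤ C)
    (H : ∀ j : ℤ, ∫⁻ x, g x ^ p.toReal ∂(unitRestrict P j) ≤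
      ENNReal.ofReal C * ∫⁻ x, h x ^ p.toReal ∂(unitRestrict P j)) :
    amalgamNorm P p q g ≤ (C ^ (1 / p.toReal)).toNNReal * amalgamNorm P p q h := by
  have hpr : 0 < p.toReal := ENNReal.toReal_pos hp0.ne' hp.ne
  refine amalgamNorm_le_of_eLpNorm_le hq fun j => ?_
  rw [eLpNorm_eq_lintegral_rpow_enorm_toReal hp0.ne' hp.ne,
    eLpNorm_eq_lintegral_rpow_enorm_toReal hp0.ne' hp.ne]
  simp only [enorm_eq_self]
  refine (ENNReal.rpow_le_rpow (H j) (by positivity)).trans (le_of_eq ?_)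
  rw [ENNReal.mul_rpow_of_nonneg _ _ (by positivity),
    ENNReal.ofReal_rpow_of_nonneg hC (by positivity)]
  rfl

/-- `X_{p,q}` embeds into `Y_{p,q}` with a constant that is uniform in `q` and in the probability
measures with the property `K`. -/
def EmbedsUniformly (K : Measure ℝ → Prop) (p : ℝ≥0∞) (X Y : Scale) : Prop :=
  ∃ C : ℝ≥0, ∀ (P : Measure ℝ) [IsProbabilityMeasure P], K P → ∀ q : ℝ≥0∞, 0 < q →
    ∀ f, IsDyadicMartingale P f → hardyNorm P p q Y f ≤ C * hardyNorm P p q X f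

theorem EmbedsUniformly.refl (K : Measure ℝ → Prop) (p : ℝ≥0∞) (X : Scale) :
    EmbedsUniformly K p X X :=
  ⟨1, fun P _ _ q _ f _ => by rw [ENNReal.coe_one, one_mul]⟩

theorem EmbedsUniformly.trans {K : Measure ℝ → Prop} {X Y Z : Scale}
    (h : EmbedsUniformly K p X Y) (h' : EmbedsUniformly K p Y Z) : EmbedsUniformly K p X Z := by
  obtain ⟨C, h⟩ := h
  obtain ⟨D, h'⟩ := h'
  refine ⟨D * C, fun P _ hP q hq f hf => (h' P hP q hq f hf).trans ?_⟩
  rw [ENNReal.coe_mul, mul_assoc]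
  exact mul_le_mul_right (h P hP q hq f hf) _

theorem EmbedsUniformly.embedsWith {K : Measure ℝ → Prop} {X Y : Scale}
    (h : EmbedsUniformly K p X Y) : ∃ C : ℝ≥0, ∀ D, C ≤ D → ∀ (P : Measure ℝ)
      [IsProbabilityMeasure P], K P → ∀ q : ℝ≥0∞, 0 < q → EmbedsWith P p q X Y D := by
  obtain ⟨C, h⟩ := h
  refine ⟨C, fun D hCD P _ hP q hq => ?_⟩
  have h' : ∀ f, IsDyadicMartingale P f → hardyNorm P p q Y f ≤ D * hardyNorm P p q X f :=
    fun f hf => (h P hP q hq f hf).trans (mul_le_mul_left (ENNReal.coe_le_coe.2 hCD) _)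
  exact ⟨fun f hf => ⟨hf.1, (h' f hf.1).trans_lt (ENNReal.mul_lt_top ENNReal.coe_lt_top hf.2)⟩, h'⟩

/-- Dividing by `C` brings the bound inside the infimum. Positivity of `C` matters when no control
exists: the right side must be `∞`, not `0 * ∞ = 0`. -/
theorem le_mul_iInf_control {Φ : (ℕ → ℝ → ℝ≥0) → Prop} {N : (ℕ → ℝ → ℝ≥0) → ℝ≥0∞} {t : ℝ≥0∞}
    {C : ℝ≥0} (hC : 0 < C) (h : ∀ ϱ, IsControl ϱ → Φ ϱ → t ≤ C * N ϱ) :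
    t ≤ C * ⨅ (ϱ : ℕ → ℝ → ℝ≥0) (_ : IsControl ϱ) (_ : Φ ϱ), N ϱ := by
  have hC0 : (C : ℝ≥0∞) ≠ 0 := ENNReal.coe_ne_zero.2 hC.ne'
  rw [← ENNReal.div_le_iff' hC0 ENNReal.coe_ne_top]
  refine le_iInf fun ϱ => le_iInf fun h1 => le_iInf fun h2 => ?_
  rw [ENNReal.div_le_iff' hC0 ENNReal.coe_ne_top]
  exact h ϱ h1 h2

theorem partialSquareFunction_le_iff {f : ℕ → ℝ → ℝ} {n : ℕ} {x : ℝ} {c : ℝ≥0} :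
    partialSquareFunction f n x ≤ (c : ℝ≥0∞) ↔ sqSum f n x ≤ (c : ℝ) ^ 2 := by
  have e : partialSquareFunction f n x = ENNReal.ofReal (√(sqSum f n x)) := by
    rw [partialSquareFunction, Real.sqrt_eq_rpow,
      ← ENNReal.ofReal_rpow_of_nonneg (sqSum_nonneg f n x) (by norm_num), sqSum,
      ENNReal.ofReal_sum_of_nonneg fun i _ => sq_nonneg _]
    simp only [sq_enorm_eq]
  rw [e, ← ENNReal.ofReal_coe_nnreal, ENNReal.ofReal_le_ofReal_iff c.coe_nonneg,
    Real.sqrt_le_left c.coe_nonneg]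

theorem enorm_le_iff_sq {t : ℝ} {c : ℝ≥0} : ‖t‖ₑ ≤ (c : ℝ≥0∞) ↔ t ^ 2 ≤ (c : ℝ) ^ 2 := by
  rw [Real.enorm_eq_ofReal_abs, ← ENNReal.ofReal_coe_nnreal,
    ENNReal.ofReal_le_ofReal_iff c.coe_nonneg, sq_le_sq, abs_of_nonneg c.coe_nonneg]

theorem exists_embeds_Hs (hp0 : 0 < p) (hp : p < ∞) (K : Measure ℝ → Prop) (hp2 : p ≤ 2) :
    EmbedsUniformly K p .Hs .Hstar ∧ EmbedsUniformly K p .Hs .HS := by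
  have hpr : 0 < p.toReal := ENNReal.toReal_pos hp0.ne' hp.ne
  obtain ⟨C, hC, h⟩ := exists_bounds_condSum hpr
    (by simpa using ENNReal.toReal_mono ENNReal.ofNat_ne_top hp2)
  refine ⟨⟨_, fun P _ _ q hq f hf => amalgamNorm_le_of_lintegral_le hp0 hp hq hC.le fun j => ?_⟩,
    ⟨_, fun P _ _ q hq f hf => amalgamNorm_le_of_lintegral_le hp0 hp hq hC.le fun j => ?_⟩⟩
  · exact (represents_maximalFunction hf hpr).lintegral_le (represents_condSquareFunction hf hpr)
      hC.le fun n => (h P j _ _ (centered_isLevelMartingale hf.1) (centered_zero f)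
        (condSq_isCondSquare (levelConst_of_martingale hf.1)) n).1
  · exact (represents_squareFunction hf hpr).lintegral_le (represents_condSquareFunction hf hpr)
      hC.le fun n => (h P j _ _ (centered_isLevelMartingale hf.1) (centered_zero f)
        (condSq_isCondSquare (levelConst_of_martingale hf.1)) n).2

theorem exists_embeds_to_Hs (hp0 : 0 < p) (hp : p < ∞) (K : Measure ℝ → Prop) (hp2 : 2 ≤ p) :
    EmbedsUniformly K p .Hstar .Hs ∧ EmbedsUniformly K p .HS .Hs := by
  have hpr : 0 < p.toReal := ENNReal.toReal_pos hp0.ne' hp.ne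
  obtain ⟨C, hC, h⟩ := exists_condSum_bounds (p := p.toReal)
    (by simpa using ENNReal.toReal_mono hp.ne hp2)
  refine ⟨⟨_, fun P _ _ q hq f hf => amalgamNorm_le_of_lintegral_le hp0 hp hq hC.le fun j => ?_⟩,
    ⟨_, fun P _ _ q hq f hf => amalgamNorm_le_of_lintegral_le hp0 hp hq hC.le fun j => ?_⟩⟩
  · exact (represents_condSquareFunction hf hpr).lintegral_le (represents_maximalFunction hf hpr)
      hC.le fun n => (h P j _ _ (centered_isLevelMartingale hf.1) (centered_zero f)
        (condSq_isCondSquare (levelConst_of_martingale hf.1)) n).1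
  · exact (represents_condSquareFunction hf hpr).lintegral_le (represents_squareFunction hf hpr)
      hC.le fun n => (h P j _ _ (centered_isLevelMartingale hf.1) (centered_zero f)
        (condSq_isCondSquare (levelConst_of_martingale hf.1)) n).2

theorem embeds_of_forall_control {K : Measure ℝ → Prop} {Y : Scale} {C : ℝ≥0} (hC : 0 < C)
    (h : ∀ (P : Measure ℝ) [IsProbabilityMeasure P] (q : ℝ≥0∞), 0 < q → ∀ f,
      IsDyadicMartingale P f → ∀ ϱ, IsControl ϱ →
      (∀ n, ∀ᵐ x ∂P, ‖f (n + 1) x‖ₑ ≤ (ϱ n x : ℝ≥0∞)) →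
      hardyNorm P p q Y f ≤ C * amalgamNorm P p q (controlLimit ϱ)) :
    EmbedsUniformly K p .P Y :=
  ⟨C, fun P _ _ q hq f hf => le_mul_iInf_control hC (h P q hq f hf)⟩

theorem embeds_of_forall_squareControl {K : Measure ℝ → Prop} {Y : Scale} {C : ℝ≥0} (hC : 0 < C)
    (h : ∀ (P : Measure ℝ) [IsProbabilityMeasure P] (q : ℝ≥0∞), 0 < q → ∀ f,
      IsDyadicMartingale P f → ∀ ϱ, IsControl ϱ →
      (∀ n, ∀ᵐ x ∂P, partialSquareFunction f (n + 1) x ≤ (ϱ n x : ℝ≥0∞)) →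
      hardyNorm P p q Y f ≤ C * amalgamNorm P p q (controlLimit ϱ)) :
    EmbedsUniformly K p .Q Y :=
  ⟨C, fun P _ _ q hq f hf => le_mul_iInf_control hC (h P q hq f hf)⟩

theorem amalgamNorm_mono_ae {P : Measure ℝ} {q : ℝ≥0∞} (hq : 0 < q) {g h : ℝ → ℝ≥0∞}
    (H : ∀ᵐ x ∂P, g x ≤ h x) : amalgamNorm P p q g ≤ amalgamNorm P p q h := by
  rw [← one_mul (amalgamNorm P p q h)]
  refine amalgamNorm_le_of_eLpNorm_le hq fun j => ?_
  rw [one_mul]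
  refine eLpNorm_mono_enorm_ae ?_
  filter_upwards [ae_restrict_of_ae H] with x hx
  simpa using hx

theorem embeds_P_Hstar (K : Measure ℝ → Prop) : EmbedsUniformly K p .P .Hstar := by
  refine embeds_of_forall_control zero_lt_one fun P _ q hq f hf ϱ _ h => ?_
  rw [ENNReal.coe_one, one_mul]
  refine amalgamNorm_mono_ae hq ?_
  filter_upwards [ae_all_iff.2 h, hf.2] with x hx h0
  refine iSup_le fun n => ?_
  cases n with
  | zero => rw [h0, Pi.zero_apply, enorm_zero]; exact zero_le
  | succ n => exact (hx n).trans (le_iSup (fun n => (ϱ n x : ℝ≥0∞)) n)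

theorem squareFunction_eq_iSup (f : ℕ → ℝ → ℝ) (x : ℝ) :
    squareFunction f x = ⨆ n, partialSquareFunction f (n + 1) x := by
  simp only [squareFunction, partialSquareFunction]
  rw [← iSup_rpow _ (by norm_num), ENNReal.tsum_eq_iSup_nat' (Filter.tendsto_add_atTop_nat 1)]

theorem embeds_Q_HS (K : Measure ℝ → Prop) : EmbedsUniformly K p .Q .HS := by
  refine embeds_of_forall_squareControl zero_lt_one fun P _ q hq f hf ϱ _ h => ?_
  rw [ENNReal.coe_one, one_mul]
  refine amalgamNorm_mono_ae hq ?_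
  filter_upwards [ae_all_iff.2 h] with x hx
  rw [squareFunction_eq_iSup]
  exact iSup_mono hx

theorem embeds_P_HS_Hs (hp0 : 0 < p) (hp : p < ∞) (K : Measure ℝ → Prop) :
    EmbedsUniformly K p .P .HS ∧ EmbedsUniformly K p .P .Hs := by
  have hpr : 0 < p.toReal := ENNReal.toReal_pos hp0.ne' hp.ne
  obtain ⟨C, hC, h⟩ := exists_bounds_of_abs_le hpr
  have hC' : 0 < (C ^ (1 / p.toReal)).toNNReal := Real.toNNReal_pos.2 (by positivity)
  have key : ∀ (P : Measure ℝ) [IsProbabilityMeasure P] (f : ℕ → ℝ → ℝ),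
      IsDyadicMartingale P f → ∀ ϱ : ℕ → ℝ → ℝ≥0,
      (∀ n, ∀ᵐ x ∂P, ‖f (n + 1) x‖ₑ ≤ (ϱ n x : ℝ≥0∞)) → ∀ j : ℤ,
      ∀ᵐ x ∂(unitRestrict P j), ∀ n, centered f (n + 1) x ^ 2 ≤ (ϱ n x : ℝ) ^ 2 := by
    intro P _ f hf ϱ hb j
    refine ae_restrict_of_ae ?_
    filter_upwards [ae_all_iff.2 hb, hf.2] with x hx h0 n
    rw [centered, h0, Pi.zero_apply, sub_zero]
    exact enorm_le_iff_sq.1 (hx n)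
  refine ⟨embeds_of_forall_control hC' fun P _ q hq f hf ϱ hϱ hb =>
      amalgamNorm_le_of_lintegral_le hp0 hp hq hC.le fun j => ?_,
    embeds_of_forall_control hC' fun P _ q hq f hf ϱ hϱ hb =>
      amalgamNorm_le_of_lintegral_le hp0 hp hq hC.le fun j => ?_⟩
  · exact (represents_squareFunction hf hpr).lintegral_le (represents_controlLimit P hϱ hpr) hC.le
      fun n => (h P j _ _ _ (centered_isLevelMartingale hf.1) (centered_zero f)
        (condSq_isCondSquare (levelConst_of_martingale hf.1)) (isLevelControl_of_isControl hϱ)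
        (key P f hf ϱ hb j) n).1
  · exact (represents_condSquareFunction hf hpr).lintegral_le (represents_controlLimit P hϱ hpr)
      hC.le fun n => (h P j _ _ _ (centered_isLevelMartingale hf.1) (centered_zero f)
        (condSq_isCondSquare (levelConst_of_martingale hf.1)) (isLevelControl_of_isControl hϱ)
        (key P f hf ϱ hb j) n).2

theorem embeds_Q_Hstar_Hs (hp0 : 0 < p) (hp : p < ∞) (K : Measure ℝ → Prop) :
    EmbedsUniformly K p .Q .Hstar ∧ EmbedsUniformly K p .Q .Hs := by
  have hpr : 0 < p.toReal := ENNReal.toReal_pos hp0.ne' hp.ne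
  obtain ⟨C, hC, h⟩ := exists_bounds_of_sqSum_le hpr
  have hC' : 0 < (C ^ (1 / p.toReal)).toNNReal := Real.toNNReal_pos.2 (by positivity)
  have key : ∀ (P : Measure ℝ) [IsProbabilityMeasure P] (f : ℕ → ℝ → ℝ) (ϱ : ℕ → ℝ → ℝ≥0),
      (∀ n, ∀ᵐ x ∂P, partialSquareFunction f (n + 1) x ≤ (ϱ n x : ℝ≥0∞)) → ∀ j : ℤ,
      ∀ᵐ x ∂(unitRestrict P j), ∀ n, sqSum (centered f) (n + 1) x ≤ (ϱ n x : ℝ) ^ 2 := by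
    intro P _ f ϱ hb j
    refine ae_restrict_of_ae ?_
    filter_upwards [ae_all_iff.2 hb] with x hx n
    rw [sqSum_centered]
    exact partialSquareFunction_le_iff.1 (hx n)
  refine ⟨embeds_of_forall_squareControl hC' fun P _ q hq f hf ϱ hϱ hb =>
      amalgamNorm_le_of_lintegral_le hp0 hp hq hC.le fun j => ?_,
    embeds_of_forall_squareControl hC' fun P _ q hq f hf ϱ hϱ hb =>
      amalgamNorm_le_of_lintegral_le hp0 hp hq hC.le fun j => ?_⟩
  · exact (represents_maximalFunction hf hpr).lintegral_le (represents_controlLimit P hϱ hpr) hC.le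
      fun n => (h P j _ _ _ (centered_isLevelMartingale hf.1) (centered_zero f)
        (condSq_isCondSquare (levelConst_of_martingale hf.1)) (isLevelControl_of_isControl hϱ)
        (key P f ϱ hb j) n).1
  · exact (represents_condSquareFunction hf hpr).lintegral_le (represents_controlLimit P hϱ hpr)
      hC.le fun n => (h P j _ _ _ (centered_isLevelMartingale hf.1) (centered_zero f)
        (condSq_isCondSquare (levelConst_of_martingale hf.1)) (isLevelControl_of_isControl hϱ)
        (key P f ϱ hb j) n).2

end

/-! ### Dyadic averages and regular measures -/

section

variable {P : Measure ℝ} [IsProbabilityMeasure P] {n : ℕ} {j : ℤ} {h : ℝ → ℝ}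

/-- The average of `h` over the dyadic interval of length `2 ^ (-n)` that contains `x`. -/
noncomputable def dyadicAverage (P : Measure ℝ) (n : ℕ) (h : ℝ → ℝ) (x : ℝ) : ℝ :=
  (∫ y in dyadicInterval n ⌊(2 : ℝ) ^ n * x⌋, h y ∂P) / P.real (dyadicInterval n ⌊(2 : ℝ) ^ n * x⌋)

theorem dyadicAverage_level (P : Measure ℝ) (n : ℕ) (h : ℝ → ℝ) :
    LevelConst n (dyadicAverage P n h) :=
  fun x y e => by rw [dyadicAverage, dyadicAverage, e]

theorem setIntegral_levelConst {μ : Measure ℝ} {u : ℝ → ℝ} (hu : LevelConst n u) {k : ℤ} {x : ℝ}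
    (hx : ⌊(2 : ℝ) ^ n * x⌋ = k) :
    ∫ y in dyadicInterval n k, u y ∂μ = μ.real (dyadicInterval n k) * u x := by
  rw [setIntegral_congr_fun (s := dyadicInterval n k) (g := fun _ => u x) measurableSet_Ico
    fun y hy => hu ((mem_dyadicInterval_iff.1 hy).trans hx.symm), setIntegral_const, smul_eq_mul]

theorem setIntegral_dyadicAverage (h : ℝ → ℝ) (k : ℤ) :
    ∫ x in dyadicInterval n k, dyadicAverage P n h x ∂P = ∫ x in dyadicInterval n k, h x ∂P := by
  have hk : ⌊(2 : ℝ) ^ n * ((k : ℝ) / 2 ^ n)⌋ = k := by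
    rw [mul_div_cancel₀ _ (by positivity), Int.floor_intCast]
  rw [setIntegral_levelConst (dyadicAverage_level P n h) hk, dyadicAverage, hk]
  -- On a null interval the quotient has the default value `0`, and both integrals vanish.
  by_cases h0 : P.real (dyadicInterval n k) = 0
  · rw [h0, zero_mul, setIntegral_measure_zero]
    rwa [measureReal_eq_zero_iff] at h0
  · rw [mul_div_cancel₀ _ h0]

/-- Tested with `ξ`, the averages of levels `n` and `n + 1` both give the integral of `ξ * h`.
Explicit averages are used because `h` need not be integrable on the whole line. -/
theorem dyadicAverage_isLevelMartingale {m : ℕ} (hh : LevelConst m h) :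
    IsLevelMartingale (unitRestrict P j) fun n => dyadicAverage P n h where
  level n := dyadicAverage_level P n h
  orth n ξ hξ := by
    have aux : ∀ i, LevelConst i ξ → ∫ x, ξ x * dyadicAverage P i h x ∂(unitRestrict P j) =
        ∫ x, ξ x * h x ∂(unitRestrict P j) := fun i hi =>
      integral_mul_congr_of_atoms ((dyadicAverage_level P i h).mono (le_max_left i m))
        (hh.mono (le_max_right i m)) hi fun k _ => setIntegral_dyadicAverage h k
    have L1 := dyadicAverage_level P (n + 1) h
    have L2 := (dyadicAverage_level P n h).mono n.le_succ
    simp only [mul_sub]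
    rw [integral_sub ((hξ.mono n.le_succ).mul L1).integrable
      ((hξ.mono n.le_succ).mul L2).integrable, aux n hξ, aux (n + 1) (hξ.mono n.le_succ), sub_self]

theorem dyadicAverage_nonneg {μ : Measure ℝ} (h0 : ∀ x, 0 ≤ h x) (n : ℕ) (x : ℝ) :
    0 ≤ dyadicAverage μ n h x :=
  div_nonneg (integral_nonneg h0) measureReal_nonneg

theorem LevelConst.integrableOn_dyadicInterval {m : ℕ} (hh : LevelConst m h) (x : ℝ) :
    IntegrableOn h (dyadicInterval n ⌊(2 : ℝ) ^ n * x⌋) P :=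
  IntegrableOn.mono_set (hh.integrable (P := P) (j := ⌊x⌋))
    (dyadicInterval_subset_unit (floor_mem_of_mem_unit ⟨Int.floor_le x, Int.lt_floor_add_one x⟩))

theorem dyadicAverage_mono {m : ℕ} {g : ℝ → ℝ} (hg : LevelConst m g) (hh : LevelConst m h)
    (hgh : ∀ x, g x ≤ h x) (n : ℕ) (x : ℝ) : dyadicAverage P n g x ≤ dyadicAverage P n h x :=
  div_le_div_of_nonneg_right (setIntegral_mono (hg.integrableOn_dyadicInterval x)
    (hh.integrableOn_dyadicInterval x) hgh) measureReal_nonneg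

theorem ae_of_forall_unitRestrict {μ : Measure ℝ} {Φ : ℝ → Prop}
    (H : ∀ j : ℤ, ∀ᵐ x ∂(unitRestrict μ j), Φ x) : ∀ᵐ x ∂μ, Φ x := by
  have := (ae_restrict_iUnion_iff (μ := μ) (fun j : ℤ => Ico (j : ℝ) (j + 1)) Φ).2 H
  rwa [iUnion_Ico_intCast, Measure.restrict_univ] at this

theorem ae_measureReal_dyadicInterval_ne_zero (P : Measure ℝ) [IsProbabilityMeasure P] (n : ℕ) :
    ∀ᵐ x ∂P, P.real (dyadicInterval n ⌊(2 : ℝ) ^ n * x⌋) ≠ 0 := by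
  have : ∀ k : ℤ, ∀ᵐ x ∂P, ⌊(2 : ℝ) ^ n * x⌋ = k → P.real (dyadicInterval n k) ≠ 0 := by
    intro k
    by_cases hk : P.real (dyadicInterval n k) = 0
    · rw [measureReal_eq_zero_iff] at hk
      filter_upwards [measure_eq_zero_iff_ae_notMem.1 hk] with x hx e
      exact absurd (mem_dyadicInterval_iff.2 e) hx
    · exact Filter.Eventually.of_forall fun x _ => hk
  filter_upwards [ae_all_iff.2 this] with x hx using hx _ rfl

/-- A level `n` function with the same integrals as `h` over the dyadic intervals of level `n` is
the average of `h`. -/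
theorem ae_eq_dyadicAverage {u : ℝ → ℝ} (hu : LevelConst n u)
    (H : ∀ k ∈ Finset.Ico (j * 2 ^ n) ((j + 1) * 2 ^ n),
      ∫ x in dyadicInterval n k, h x ∂P = ∫ x in dyadicInterval n k, u x ∂P) :
    ∀ᵐ x ∂(unitRestrict P j), dyadicAverage P n h x = u x := by
  filter_upwards [ae_restrict_of_ae (ae_measureReal_dyadicInterval_ne_zero P n),
    ae_restrict_mem measurableSet_Ico] with x hx hxj
  rw [dyadicAverage, H _ (floor_mem_of_mem_unit hxj), setIntegral_levelConst hu rfl,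
    mul_div_cancel_left₀ _ hx]

theorem ae_dyadicAverage_eq_self (hh : LevelConst n h) :
    ∀ᵐ x ∂(unitRestrict P j), dyadicAverage P n h x = h x :=
  ae_eq_dyadicAverage hh fun _ _ => rfl

/-- Regularity concerns martingales, which are integrable, so `h` is first cut off to a unit
interval. The martingale closed by the cut-off function equals that function at time `n + 1` and the
average of `h` at time `n`, on that interval. -/
theorem IsRegularBasis.le_dyadicAverage {R : ℝ} (hR : IsRegularBasis P R)
    (hh : LevelConst (n + 1) h) (h0 : ∀ x, 0 ≤ h x) :
    ∀ᵐ x ∂P, h x ≤ R * dyadicAverage P n h x := by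
  refine ae_of_forall_unitRestrict fun j => ?_
  set u : ℝ → ℝ := (Ico (j : ℝ) (j + 1)).indicator h with hu
  have hu0 : ∀ x, 0 ≤ u x := fun x => indicator_nonneg (fun x _ => h0 x) x
  have huint : Integrable u P :=
    (integrable_indicator_iff measurableSet_Ico).2 (hh.integrable (P := P) (j := j))
  have hum : StronglyMeasurable[dyadicFiltration (n + 1)] u :=
    (hh.measurable_filtration.stronglyMeasurable).indicator (measurableSet_unit (n + 1) j)
  have hreg := hR (fun i => P[u | dyadicFiltration i]) (martingale_condExp u dyadicFiltration P)
    (fun i => condExp_nonneg (Filter.Eventually.of_forall hu0)) n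
  have hself : P[u | dyadicFiltration (n + 1)] = u :=
    condExp_of_stronglyMeasurable (dyadicFiltration.le _) hum huint
  have hlev : LevelConst n (P[u | dyadicFiltration n]) :=
    LevelConst.of_measurable stronglyMeasurable_condExp.measurable
  have havg := ae_eq_dyadicAverage (P := P) (j := j) (h := h) hlev fun k hk => by
    rw [setIntegral_condExp (dyadicFiltration.le n) huint (measurableSet_dyadicInterval n k)]
    refine setIntegral_congr_fun measurableSet_Ico fun x hx => ?_
    rw [hu, indicator_of_mem (dyadicInterval_subset_unit hk hx)]
  filter_upwards [ae_restrict_of_ae hreg, havg, ae_restrict_mem measurableSet_Ico] with x h1 h2 h3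
  simp only [hself] at h1
  rwa [h2, ← indicator_of_mem h3 h]

/-- In the regular case an adapted non-decreasing sequence has a control of comparable size. -/
theorem exists_control_of_regular {p R : ℝ} (hp : 0 < p) (hR0 : 0 < R) :
    ∃ C : ℝ, 0 < C ∧ ∀ (P : Measure ℝ) [IsProbabilityMeasure P], IsRegularBasis P R →
      ∀ X : ℕ → ℝ → ℝ, IsLevelControl X → ∃ ϱ : ℕ → ℝ → ℝ≥0, IsControl ϱ ∧
        (∀ n, ∀ᵐ x ∂P, X (n + 1) x ≤ ϱ n x) ∧
        ∀ (j : ℤ) N, ∫ x, (ϱ N x : ℝ) ^ p ∂(unitRestrict P j) ≤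
          C * ∫ x, X (N + 1) x ^ p ∂(unitRestrict P j) := by
  obtain ⟨D, hD, hdoob⟩ := doob (p := 2) (by norm_num)
  refine ⟨R ^ 2 * D, by positivity, fun P _ hR X hX => ?_⟩
  -- Passing to the power `p / 2` turns the `p`-th moment into a second moment, so Doob's inequality
  -- in `L_2` serves every `p > 0`.
  set s := p / 2 with hs
  have hs0 : 0 < s := by positivity
  have LX : ∀ n, LevelConst n fun x => X n x ^ s := fun n => (hX.level n).rpow s
  have X0 : ∀ n x, 0 ≤ X n x ^ s := fun n x => Real.rpow_nonneg (hX.nonneg n x) s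
  -- By regularity `Y m`, of level `m`, dominates `X (m + 1) ^ s`; its running maximum is moreover
  -- monotone in time and yields the control.
  set Y : ℕ → ℝ → ℝ := fun m x => R * dyadicAverage P m (fun y => X (m + 1) y ^ s) x with hY
  have LY : ∀ n, LevelConst n (Y n) := fun n => (dyadicAverage_level P n _).comp fun t => R * t
  have LM := runMax_level LY
  have Y0 : ∀ n x, 0 ≤ Y n x := fun n x =>
    mul_nonneg hR0.le (dyadicAverage_nonneg (X0 (n + 1)) n x)
  have hval : ∀ n x, (((runMax Y n x ^ (1 / s)).toNNReal : ℝ≥0) : ℝ) = runMax Y n x ^ (1 / s) :=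
    fun n x => Real.coe_toNNReal _ (Real.rpow_nonneg (runMax_nonneg _ _ _) _)
  refine ⟨fun n x => (runMax Y n x ^ (1 / s)).toNNReal, ⟨fun n => ?_, ?_⟩, fun n => ?_,
    fun j N => ?_⟩
  · exact ((LM n).comp fun t => (t ^ (1 / s)).toNNReal).measurable_filtration
  · exact monotone_nat_of_le_succ fun n x => Real.toNNReal_le_toNNReal
      (Real.rpow_le_rpow (runMax_nonneg _ _ _) (le_max_left _ _) (by positivity))
  · filter_upwards [hR.le_dyadicAverage (LX (n + 1)) (X0 (n + 1))] with x hx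
    rw [hval]
    have h1 : X (n + 1) x ^ s ≤ runMax Y n x :=
      hx.trans ((le_abs_self _).trans (abs_le_runMax Y le_rfl x))
    have h2 := Real.rpow_le_rpow (X0 (n + 1) x) h1 (by positivity : 0 ≤ 1 / s)
    rwa [← Real.rpow_mul (hX.nonneg _ x), mul_one_div_cancel hs0.ne', Real.rpow_one] at h2
  · set g : ℕ → ℝ → ℝ := fun m => dyadicAverage P m fun y => X (N + 1) y ^ s
    have hg : IsLevelMartingale (unitRestrict P j) g := dyadicAverage_isLevelMartingale (LX (N + 1))
    -- The functions averaged in `Y` vary with `m`, but `X` increases, so up to time `N` they are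
    -- all dominated by the single function `X (N + 1) ^ s`. Its averages form a martingale that
    -- reaches it at time `N + 1`.
    have hYg : ∀ x, runMax Y N x ≤ R * runMax g (N + 1) x := by
      intro x
      refine runMax_le fun k hk => ?_
      rw [abs_of_nonneg (Y0 k x)]
      refine mul_le_mul_of_nonneg_left ?_ hR0.le
      refine le_trans ?_ ((le_abs_self _).trans (abs_le_runMax g (hk.trans N.le_succ) x))
      exact dyadicAverage_mono ((LX (k + 1)).mono (Nat.succ_le_succ hk)) (LX (N + 1))
        (fun y => Real.rpow_le_rpow (hX.nonneg _ y) (hX.mono y (Nat.succ_le_succ hk)) hs0.le) k x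
    have h1 := hdoob P j g hg (N + 1)
    have h2 : ∫ x, |g (N + 1) x| ^ (2 : ℝ) ∂(unitRestrict P j) =
        ∫ x, X (N + 1) x ^ p ∂(unitRestrict P j) := by
      refine integral_congr_ae ?_
      filter_upwards [ae_dyadicAverage_eq_self (P := P) (j := j) (LX (N + 1))] with x hx
      simp only [g]
      rw [hx, abs_of_nonneg (X0 _ x), ← Real.rpow_mul (hX.nonneg _ x), hs,
        div_mul_cancel₀ _ two_ne_zero]
    rw [h2] at h1
    calc ∫ x, (((runMax Y N x ^ (1 / s)).toNNReal : ℝ≥0) : ℝ) ^ p ∂(unitRestrict P j)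
        ≤ ∫ x, R ^ 2 * runMax g (N + 1) x ^ (2 : ℝ) ∂(unitRestrict P j) := by
          refine integral_mono ((LM N).comp
            fun t => (((t ^ (1 / s)).toNNReal : ℝ≥0) : ℝ) ^ p).integrable
            (((runMax_level hg.level (N + 1)).rpow 2).integrable.const_mul _) fun x => ?_
          simp only [hval]
          rw [← Real.rpow_mul (runMax_nonneg _ _ _), hs, one_div_div,
            div_mul_cancel₀ _ hp.ne', Real.rpow_ofNat, Real.rpow_ofNat, ← mul_pow]
          exact pow_le_pow_left₀ (runMax_nonneg _ _ _) (hYg x) 2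
      _ ≤ R ^ 2 * (D * ∫ x, X (N + 1) x ^ p ∂(unitRestrict P j)) := by
          rw [integral_const_mul]
          exact mul_le_mul_of_nonneg_left h1 (by positivity)
      _ = _ := by ring

end

/-! ### Embeddings in the regular case -/

section

variable {p : ℝ≥0∞} {f : ℕ → ℝ → ℝ}

theorem predictableNorm_le {P : Measure ℝ} {q : ℝ≥0∞} {ϱ : ℕ → ℝ → ℝ≥0} (hϱ : IsControl ϱ)
    (h : ∀ n, ∀ᵐ x ∂P, ‖f (n + 1) x‖ₑ ≤ (ϱ n x : ℝ≥0∞)) :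
    predictableNorm P p q f ≤ amalgamNorm P p q (controlLimit ϱ) :=
  iInf_le_of_le ϱ (iInf_le_of_le hϱ (iInf_le_of_le h le_rfl))

theorem predictableSquareNorm_le {P : Measure ℝ} {q : ℝ≥0∞} {ϱ : ℕ → ℝ → ℝ≥0} (hϱ : IsControl ϱ)
    (h : ∀ n, ∀ᵐ x ∂P, partialSquareFunction f (n + 1) x ≤ (ϱ n x : ℝ≥0∞)) :
    predictableSquareNorm P p q f ≤ amalgamNorm P p q (controlLimit ϱ) :=
  iInf_le_of_le ϱ (iInf_le_of_le hϱ (iInf_le_of_le h le_rfl))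

theorem isLevelControl_runMax (hf : ∀ n, LevelConst n (f n)) : IsLevelControl (runMax f) where
  level := runMax_level hf
  nonneg := runMax_nonneg f
  mono _ := monotone_nat_of_le_succ fun _ => le_max_left _ _

theorem isLevelControl_sqrt_sqSum (hf : ∀ n, LevelConst n (f n)) :
    IsLevelControl fun n x => √(sqSum f n x) where
  level n := (sqSum_level hf n).comp Real.sqrt
  nonneg _ _ := Real.sqrt_nonneg _
  mono x := monotone_nat_of_le_succ fun n => Real.sqrt_le_sqrt (sqSum_le_succ f n x)

theorem embeds_Hstar_P_of_regular (hp0 : 0 < p) (hp : p < ∞) {R : ℝ} (hR0 : 0 < R) :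
    EmbedsUniformly (fun P => IsRegularBasis P R) p .Hstar .P := by
  have hpr : 0 < p.toReal := ENNReal.toReal_pos hp0.ne' hp.ne
  obtain ⟨C, hC, h⟩ := exists_control_of_regular hpr hR0
  refine ⟨(C ^ (1 / p.toReal)).toNNReal, fun P _ hR q hq f hf => ?_⟩
  have L := centered_level (levelConst_of_martingale hf.1)
  obtain ⟨ϱ, hϱ, hle, hbound⟩ := h P hR _ (isLevelControl_runMax L)
  refine (predictableNorm_le hϱ fun n => ?_).trans
    (amalgamNorm_le_of_lintegral_le hp0 hp hq hC.le fun j => ?_)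
  · filter_upwards [hle n, hf.2] with x hx h0
    rw [enorm_le_iff_sq, sq_le_sq, abs_of_nonneg (ϱ n x).coe_nonneg]
    refine le_trans ?_ ((abs_le_runMax (centered f) le_rfl x).trans hx)
    rw [centered, h0, Pi.zero_apply, sub_zero]
  · exact (represents_controlLimit P hϱ hpr).lintegral_le (represents_maximalFunction hf hpr)
      hC.le (hbound j)

theorem embeds_HS_Q_of_regular (hp0 : 0 < p) (hp : p < ∞) {R : ℝ} (hR0 : 0 < R) :
    EmbedsUniformly (fun P => IsRegularBasis P R) p .HS .Q := by
  have hpr : 0 < p.toReal := ENNReal.toReal_pos hp0.ne' hp.ne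
  obtain ⟨C, hC, h⟩ := exists_control_of_regular hpr hR0
  refine ⟨(C ^ (1 / p.toReal)).toNNReal, fun P _ hR q hq f hf => ?_⟩
  have L := centered_level (levelConst_of_martingale hf.1)
  obtain ⟨ϱ, hϱ, hle, hbound⟩ := h P hR _ (isLevelControl_sqrt_sqSum L)
  refine (predictableSquareNorm_le hϱ fun n => ?_).trans
    (amalgamNorm_le_of_lintegral_le hp0 hp hq hC.le fun j => ?_)
  · filter_upwards [hle n] with x hx
    rw [partialSquareFunction_le_iff, ← sqSum_centered]
    exact (Real.sqrt_le_left (ϱ n x).coe_nonneg).1 hx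
  · simp only [sqrt_rpow (sqSum_nonneg _ _ _)] at hbound
    exact (represents_controlLimit P hϱ hpr).lintegral_le (represents_squareFunction hf hpr)
      hC.le (hbound j)

theorem IsRegularBasis.sq_diff_le_condSq {P : Measure ℝ} [IsProbabilityMeasure P] {R : ℝ}
    (hR : IsRegularBasis P R) (hf : ∀ n, LevelConst n (f n)) (n : ℕ) :
    ∀ᵐ x ∂P, (f (n + 1) x - f n x) ^ 2 ≤ R * condSq P f n x := by
  have L : LevelConst (n + 1) fun x => (f (n + 1) x - f n x) ^ 2 :=
    (diff_level hf le_rfl).comp fun t => t ^ 2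
  refine ae_of_forall_unitRestrict fun j => ?_
  filter_upwards [ae_restrict_of_ae (hR.le_dyadicAverage L fun _ => sq_nonneg _),
    ae_eq_dyadicAverage (P := P) (j := j) (condSq_level P f n)
      fun k hk => setIntegral_condSq hf hk] with x h1 h2
  rwa [h2] at h1

/-- Summing `sq_diff_le_condSq` bounds the square function by `√R` times the conditional one, which
is already predictable; Doob's inequality is not needed. -/
theorem embeds_Hs_Q_of_regular (hp0 : 0 < p) (hp : p < ∞) {R : ℝ} (hR0 : 0 < R) :
    EmbedsUniformly (fun P => IsRegularBasis P R) p .Hs .Q := by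
  have hpr : 0 < p.toReal := ENNReal.toReal_pos hp0.ne' hp.ne
  have hC : 0 < R ^ (p.toReal / 2) := by positivity
  refine ⟨((R ^ (p.toReal / 2)) ^ (1 / p.toReal)).toNNReal, fun P _ hR q hq f hf => ?_⟩
  have L := levelConst_of_martingale hf.1
  have A0 : ∀ n x, 0 ≤ ∑ i ∈ Finset.range (n + 1), condSq P f i x := fun n x =>
    Finset.sum_nonneg fun _ _ => ENNReal.toReal_nonneg
  have LA : ∀ n, LevelConst n fun x => ∑ i ∈ Finset.range (n + 1), condSq P f i x := fun n =>
    LevelConst.sum fun i hi => (condSq_level P f i).mono (Nat.lt_succ_iff.1 (Finset.mem_range.1 hi))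
  set ϱ : ℕ → ℝ → ℝ≥0 := fun n x =>
    (√(R * ∑ i ∈ Finset.range (n + 1), condSq P f i x)).toNNReal
  have hval : ∀ n x, (ϱ n x : ℝ) = √(R * ∑ i ∈ Finset.range (n + 1), condSq P f i x) :=
    fun n x => Real.coe_toNNReal _ (Real.sqrt_nonneg _)
  have hϱ : IsControl ϱ := by
    refine ⟨fun n => ((LA n).comp fun t => (√(R * t)).toNNReal).measurable_filtration,
      monotone_nat_of_le_succ fun n x => Real.toNNReal_le_toNNReal (Real.sqrt_le_sqrt
        (mul_le_mul_of_nonneg_left ?_ hR0.le))⟩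
    rw [Finset.sum_range_succ _ (n + 1)]
    exact le_add_of_nonneg_right ENNReal.toReal_nonneg
  refine (predictableSquareNorm_le hϱ fun n => ?_).trans
    (amalgamNorm_le_of_lintegral_le hp0 hp hq hC.le fun j => ?_)
  · filter_upwards [ae_all_iff.2 fun n => hR.sq_diff_le_condSq L n] with x hx
    rw [partialSquareFunction_le_iff, hval, Real.sq_sqrt (mul_nonneg hR0.le (A0 n x)),
      Finset.mul_sum]
    exact Finset.sum_le_sum fun i _ => hx i
  · refine (represents_controlLimit P hϱ hpr).lintegral_le (represents_condSquareFunction hf hpr)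
      hC.le fun N => ?_
    rw [← integral_const_mul]
    refine le_of_eq (integral_congr_ae (Filter.Eventually.of_forall fun x => ?_))
    simp only [hval]
    rw [sqrt_rpow (mul_nonneg hR0.le (A0 N x)), Real.mul_rpow hR0.le (A0 N x)]

/-- `Q` is the hub. Every space reaches it, `H^*` by way of `P` and `H^S`, and from `Q` every space
is reached, `P` by way of `H^*`. -/
theorem embeds_of_regular (hp0 : 0 < p) (hp : p < ∞) {R : ℝ} (hR0 : 0 < R) (X Y : Scale) :
    EmbedsUniformly (fun P => IsRegularBasis P R) p X Y := by
  have hPHS := (embeds_P_HS_Hs hp0 hp fun P => IsRegularBasis P R).1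
  have hQ := embeds_Q_Hstar_Hs hp0 hp fun P => IsRegularBasis P R
  have hHSQ := embeds_HS_Q_of_regular hp0 hp hR0
  have hHP := embeds_Hstar_P_of_regular hp0 hp hR0
  have toQ : EmbedsUniformly (fun P => IsRegularBasis P R) p X .Q := by
    cases X with
    | Hstar => exact hHP.trans (hPHS.trans hHSQ)
    | HS => exact hHSQ
    | Hs => exact embeds_Hs_Q_of_regular hp0 hp hR0
    | P => exact hPHS.trans hHSQ
    | Q => exact EmbedsUniformly.refl _ _ _
  refine toQ.trans ?_
  cases Y with
  | Hstar => exact hQ.1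
  | HS => exact embeds_Q_HS _
  | Hs => exact hQ.2
  | P => exact hQ.1.trans hHP
  | Q => exact EmbedsUniformly.refl _ _ _

instance : Finite Scale :=
  Finite.of_surjective (![.Hstar, .HS, .Hs, .P, .Q] : Fin 5 → Scale) fun X => by
    cases X
    exacts [⟨0, rfl⟩, ⟨1, rfl⟩, ⟨2, rfl⟩, ⟨3, rfl⟩, ⟨4, rfl⟩]

/-- The constant is chosen before the condition on `p` is known to hold; if it fails, any constant
will do. -/
theorem exists_embedsWith_of_imp {Φ : Prop} {X Y : Scale}
    (h : Φ → EmbedsUniformly (fun _ => True) p X Y) :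
    ∃ C : ℝ≥0, ∀ D, C ≤ D → Φ → ∀ (P : Measure ℝ) [IsProbabilityMeasure P] (q : ℝ≥0∞), 0 < q →
      EmbedsWith P p q X Y D := by
  by_cases hΦ : Φ
  · obtain ⟨C, hC⟩ := (h hΦ).embedsWith
    exact ⟨C, fun D hD _ P _ q hq => hC D hD P trivial q hq⟩
  · exact ⟨0, fun D _ h => absurd h hΦ⟩

end

end HardyAmalgam

open HardyAmalgam
theorem theorem3p1 (p : ℝ≥0∞) (hp0 : 0 < p) (hp : p < ∞) :
    (∃ C : ℝ≥0, ∀ (P : Measure ℝ) [IsProbabilityMeasure P] (q : ℝ≥0∞), 0 < q →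
      -- (i)
      (p ≤ 2 → EmbedsWith P p q .Hs .Hstar C ∧ EmbedsWith P p q .Hs .HS C) ∧
      -- (ii)
      (2 ≤ p → EmbedsWith P p q .Hstar .Hs C ∧ EmbedsWith P p q .HS .Hs C) ∧
      -- (iii)
      (EmbedsWith P p q .P .Hstar C ∧ EmbedsWith P p q .Q .HS C) ∧
      -- (iv)
      (EmbedsWith P p q .Q .Hstar C ∧ EmbedsWith P p q .P .HS C) ∧
      -- (v)
      (EmbedsWith P p q .P .Hs C ∧ EmbedsWith P p q .Q .Hs C)) ∧
    -- the regular case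
    (∀ R : ℝ, 0 < R → ∃ C : ℝ≥0, ∀ (P : Measure ℝ) [IsProbabilityMeasure P], IsRegularBasis P R →
      ∀ q : ℝ≥0∞, 0 < q → ∀ X Y : Scale,
        hardySpace P p q X = hardySpace P p q Y ∧ EmbedsWith P p q X Y C) := by
  constructor
  · obtain ⟨C₁, h₁⟩ := exists_embedsWith_of_imp fun h : p ≤ 2 => (exists_embeds_Hs hp0 hp _ h).1
    obtain ⟨C₂, h₂⟩ := exists_embedsWith_of_imp fun h : p ≤ 2 => (exists_embeds_Hs hp0 hp _ h).2
    obtain ⟨C₃, h₃⟩ := exists_embedsWith_of_imp fun h : 2 ≤ p => (exists_embeds_to_Hs hp0 hp _ h).1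
    obtain ⟨C₄, h₄⟩ := exists_embedsWith_of_imp fun h : 2 ≤ p => (exists_embeds_to_Hs hp0 hp _ h).2
    obtain ⟨C₅, h₅⟩ := (embeds_P_Hstar (p := p) fun _ => True).embedsWith
    obtain ⟨C₆, h₆⟩ := (embeds_Q_HS (p := p) fun _ => True).embedsWith
    obtain ⟨C₇, h₇⟩ := (embeds_Q_Hstar_Hs hp0 hp fun _ => True).1.embedsWith
    obtain ⟨C₈, h₈⟩ := (embeds_P_HS_Hs hp0 hp fun _ => True).1.embedsWith
    obtain ⟨C₉, h₉⟩ := (embeds_P_HS_Hs hp0 hp fun _ => True).2.embedsWith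
    obtain ⟨C₀, h₀⟩ := (embeds_Q_Hstar_Hs hp0 hp fun _ => True).2.embedsWith
    obtain ⟨D, hD⟩ := Finite.exists_le ![C₁, C₂, C₃, C₄, C₅, C₆, C₇, C₈, C₉, C₀]
    refine ⟨D, fun P _ q hq => ⟨fun h => ⟨?_, ?_⟩, fun h => ⟨?_, ?_⟩, ⟨?_, ?_⟩, ⟨?_, ?_⟩, ?_, ?_⟩⟩
    exacts [h₁ D (hD 0) h P q hq, h₂ D (hD 1) h P q hq, h₃ D (hD 2) h P q hq,
      h₄ D (hD 3) h P q hq, h₅ D (hD 4) P trivial q hq, h₆ D (hD 5) P trivial q hq,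
      h₇ D (hD 6) P trivial q hq, h₈ D (hD 7) P trivial q hq, h₉ D (hD 8) P trivial q hq,
      h₀ D (hD 9) P trivial q hq]
  · intro R hR0
    -- There are finitely many pairs of labels, so one bound serves them all.
    choose C hC using fun Z : Scale × Scale => (embeds_of_regular hp0 hp hR0 Z.1 Z.2).embedsWith
    obtain ⟨D, hD⟩ := Finite.exists_le C
    have key : ∀ (P : Measure ℝ) [IsProbabilityMeasure P], IsRegularBasis P R →
        ∀ q : ℝ≥0∞, 0 < q → ∀ X Y : Scale, EmbedsWith P p q X Y D :=
      fun P _ hR q hq X Y => hC (X, Y) D (hD (X, Y)) P hR q hq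
    exact ⟨D, fun P _ hR q hq X Y =>
      ⟨(key P hR q hq X Y).1.antisymm (key P hR q hq Y X).1, key P hR q hq X Y⟩⟩
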